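/- For indeterminates $q,a,c,d$ write $(x;q)_k=\prod_{j=0}^{k-1}(1-xq^j)$, $(x_1,\dots,x_m;q)_k=(x_1;q)_k\cdots(x_m;q)_k$, $[m]=(1-q^m)/(1-q)$, and let $\Phi_n(q)$ be the $n$-th cyclotomic polynomial. For a polynomial $P\in\mathbb{Z}[q,a,c,d]$ and rational functions $A,B$ in $q,a,c,d$, $A\equiv B\pmod P$ means that $A-B$ is a fraction of polynomials in $\mathbb{Z}[q,a,c,d]$ whose numerator is divisible by $P$ and whose denominator is nonzero and relatively prime to $P$. **Theorem.** Let $n\equiv 1\pmod 4$ be a positive integer. Then, modulo $\Phi_n(q)^2(a-q^n)(1-aq^n)$, $$\sum_{k=0}^{(n-1)/4}[8k+1]\frac{(q;q^4)_k^2\,(cq,dq,qa,q/a;q^4)_k}{(q^4;q^4)_k^2\,(q^4/c,q^4/d,q^4a,q^4/a;q^4)_k}(cd)^{-k}q^{5k}$$ $$\equiv\left\{q^{(1-n)/4}[n]\frac{(q^2;q^4)_{(n-1)/4}}{(q^4;q^4)_{(n-1)/4}}+q^{(1-n)/4}[n]\frac{h_q(a)}{(1-a)^2(1-a^n)(q^2,q^4;q^4)_{(n-1)/4}}\right\}\sum_{k=0}^{(n-1)/4}\frac{(q,q^3/(cd),aq,q/a;q^4)_k}{(q^2,q^4,q^4/c,q^4/d;q^4)_k}q^{4k},$$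 where $$h_q(a)=(1-aq^n)(a-q^n)\left\{(q^2;q^4)_{(n-1)/4}^2(1-a^n)-n\,(aq^2,q^2/a;q^4)_{(n-1)/4}(1-a)a^{(n-1)/2}\right\}.$$ -/

import Mathlib

/-- The `q`-shifted factorial `(x; q)_k = (1 - x) (1 - x q) ⋯ (1 - x q ^ (k - 1))`. -/
def qPoch {F : Type*} [Field F] (x q : F) (k : ℕ) : F :=
  ∏ j ∈ Finset.range k, (1 - x * q ^ j)

/-- The `q`-integer `[m] = (1 - q ^ m) / (1 - q)`. -/
def qInt {F : Type*} [Field F] (q : F) (m : ℕ) : F :=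
  (1 - q ^ m) / (1 - q)

/-- Integer polynomials in four indeterminates: `q`, `a`, `c`, `d`, numbered `0`, `1`, `2`, `3`. -/
abbrev Poly4 : Type := MvPolynomial (Fin 4) ℤ

/-- Rational functions in the indeterminates `q`, `a`, `c`, `d`. -/
abbrev Rat4 : Type := FractionRing Poly4

/-- The `i`-th indeterminate as a rational function. -/
noncomputable def ratVar (i : Fin 4) : Rat4 := algebraMap Poly4 Rat4 (MvPolynomial.X i)

/-- Congruence of rational functions modulo a polynomial `P`: the difference `A - B` can be written
as a fraction of polynomials whose numerator is divisible by `P` and whose denominator is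
relatively prime to `P`. -/
def RatCongr (P : Poly4) (A B : Rat4) : Prop :=
  ∃ u v : Poly4, v ≠ 0 ∧ IsRelPrime P v ∧
    A - B = algebraMap Poly4 Rat4 (P * u) / algebraMap Poly4 Rat4 v

/-- The modulus `Φ_n(q)^2 (a - q^n) (1 - a q^n)`. -/
noncomputable def modulus (n : ℕ) : Poly4 :=
  (Polynomial.aeval (MvPolynomial.X 0 : Poly4) (Polynomial.cyclotomic n ℤ)) ^ 2
    * (MvPolynomial.X 1 - MvPolynomial.X 0 ^ n)
    * (1 - MvPolynomial.X 1 * MvPolynomial.X 0 ^ n)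

/-- The correction numerator `h_q(a)`. -/
def hNum {F : Type*} [Field F] (n : ℕ) (q a : F) : F :=
  (1 - a * q ^ n) * (a - q ^ n) *
    (qPoch (q ^ 2) (q ^ 4) ((n - 1) / 4) ^ 2 * (1 - a ^ n)
      - (n : F) * (qPoch (a * q ^ 2) (q ^ 4) ((n - 1) / 4) * qPoch (q ^ 2 / a) (q ^ 4) ((n - 1) / 4))
        * (1 - a) * a ^ ((n - 1) / 2))

/-- The truncated sum on the left-hand side. -/
def lhsSum {F : Type*} [Field F] (n : ℕ) (q a c d : F) : F :=
  ∑ k ∈ Finset.range ((n - 1) / 4 + 1),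
    qInt q (8 * k + 1)
      * ((qPoch q (q ^ 4) k ^ 2 * qPoch (c * q) (q ^ 4) k * qPoch (d * q) (q ^ 4) k
            * qPoch (q * a) (q ^ 4) k * qPoch (q / a) (q ^ 4) k)
          / (qPoch (q ^ 4) (q ^ 4) k ^ 2 * qPoch (q ^ 4 / c) (q ^ 4) k * qPoch (q ^ 4 / d) (q ^ 4) k
            * qPoch (q ^ 4 * a) (q ^ 4) k * qPoch (q ^ 4 / a) (q ^ 4) k))
      * (c * d) ^ (-(k : ℤ)) * q ^ (5 * k)

/-- The truncated sum on the right-hand side. -/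
def rhsSum {F : Type*} [Field F] (n : ℕ) (q a c d : F) : F :=
  ∑ k ∈ Finset.range ((n - 1) / 4 + 1),
    (qPoch q (q ^ 4) k * qPoch (q ^ 3 / (c * d)) (q ^ 4) k
        * qPoch (a * q) (q ^ 4) k * qPoch (q / a) (q ^ 4) k)
      / (qPoch (q ^ 2) (q ^ 4) k * qPoch (q ^ 4) (q ^ 4) k
        * qPoch (q ^ 4 / c) (q ^ 4) k * qPoch (q ^ 4 / d) (q ^ 4) k)
      * q ^ (4 * k)

/-- The factor in braces on the right-hand side. -/
def rhsFactor {F : Type*} [Field F] (n : ℕ) (q a : F) : F :=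
  q ^ ((1 - (n : ℤ)) / 4) * qInt q n
      * (qPoch (q ^ 2) (q ^ 4) ((n - 1) / 4) / qPoch (q ^ 4) (q ^ 4) ((n - 1) / 4))
    + q ^ ((1 - (n : ℤ)) / 4) * qInt q n
      * (hNum n q a / ((1 - a) ^ 2 * (1 - a ^ n)
          * (qPoch (q ^ 2) (q ^ 4) ((n - 1) / 4) * qPoch (q ^ 4) (q ^ 4) ((n - 1) / 4))))

/-! Write n = 4N + 1. The factors Φ_n(q)², a - q^n and 1 - a q^n are pairwise coprime in the UFD
ℤ[q,a,c,d], so it suffices that each of them divides the numerator of the difference of the two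
sides. For each underlying prime p this is tested in the localization at (p): identities are proved
in its residue field, where p becomes zero, and lifted back.

On a = q^n the parameter q/a equals (q^4)^(-N) and h_q(a) vanishes. Watson's ₈φ₇ transformation then
turns the left sum exactly into the right-hand side (`lhsSum_eq_of_eq_pow`). The locus a q^n = 1
follows because both sums are invariant under a ↦ 1/a.

For Φ_n(q)², deform one pair (q;q^4)_k / (q^4;q^4)_k to (q/b;q^4)_k / (q^4 b;q^4)_k, with a
compensating weight b^k. When q^n = 1 the terms k and N - k cancel for every b
(`sum_eq_zero_of_root_of_unity`). So, after clearing denominators, the sum is a polynomial in b all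
of whose coefficients are divisible by Φ_n. Since q^n ≡ 1 mod Φ_n, its values at b = 1 (the original
sum) and at b = q^n agree mod Φ_n² (`deformedSum_sub_eq`).

At b = q^n Watson's transformation applies again and produces [n] times a closed form. The factor
[n] already supplies one Φ_n, so the cofactors need only be compared mod Φ_n, where q is a primitive
n-th root of unity and b = 1. There the complicated factor containing h_q(a) collapses to the one
produced by Watson (`reducedFactor_eq_deformedFactor`).

Watson's transformation itself comes from the q-Pfaff–Saalschütz sum and the terminating ₆φ₅ sum,
each proved by telescoping. -/

section QSeries

/-! ### Terminating summations and Watson's transformation. -/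

variable {F : Type*} [Field F]

theorem qPoch_zero (x q : F) : qPoch x q 0 = 1 := by simp [qPoch]

theorem qPoch_succ (x q : F) (k : ℕ) : qPoch x q (k + 1) = qPoch x q k * (1 - x * q ^ k) := by
  simp [qPoch, Finset.prod_range_succ]

theorem qPoch_add (x q : F) (j m : ℕ) :
    qPoch x q (j + m) = qPoch x q j * qPoch (x * q ^ j) q m := by
  simp [qPoch, Finset.prod_range_add, pow_add, mul_assoc]

theorem qPoch_one (x q : F) : qPoch x q 1 = 1 - x := by simp [qPoch]

theorem qPoch_succ_left (x q : F) (k : ℕ) :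
    qPoch x q (k + 1) = (1 - x) * qPoch (x * q) q k := by
  rw [add_comm, qPoch_add, qPoch_one, pow_one]

theorem qPoch_ne_zero_of_le {x q : F} {N k : ℕ} (h : qPoch x q N ≠ 0) (hk : k ≤ N) :
    qPoch x q k ≠ 0 := by
  obtain ⟨m, rfl⟩ := Nat.exists_eq_add_of_le hk
  rw [qPoch_add] at h
  exact left_ne_zero_of_mul h

theorem qPoch_shift_ne_zero {x q : F} {j m : ℕ} (h : qPoch x q (j + m) ≠ 0) :
    qPoch (x * q ^ j) q m ≠ 0 := by
  rw [qPoch_add] at h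
  exact right_ne_zero_of_mul h

theorem qPoch_ne_zero {x q : F} {N : ℕ} (h : ∀ i < N, 1 - x * q ^ i ≠ 0) : qPoch x q N ≠ 0 :=
  Finset.prod_ne_zero_iff.2 fun i hi => h i (Finset.mem_range.1 hi)

theorem qPoch_eq_zero {x q : F} {N k : ℕ} (h : x * q ^ N = 1) (hk : N < k) : qPoch x q k = 0 :=
  Finset.prod_eq_zero (Finset.mem_range.2 hk) (by rw [h, sub_self])

/-- Telescoping identity behind the recurrence in `k` of the balanced `₃φ₂` sum. -/
theorem saalschutz_telescope {A x X Y Z Q : F} (hx : x ≠ 0) (hQ : Q ≠ 0) (hX : X ≠ 0)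
    (hbal : Y * Z = A * Q * X) (K : ℕ) (h1 : qPoch Q Q K ≠ 0) (h2 : qPoch Y Q K ≠ 0)
    (h3 : qPoch Z Q K ≠ 0) :
    ∑ j ∈ Finset.range (K + 1),
      ((1 - Y * x) * (1 - Z * x) *
          (qPoch (1 / (x * Q)) Q j * qPoch (A * (x * Q)) Q j * qPoch X Q j
            / (qPoch Q Q j * qPoch Y Q j * qPoch Z Q j) * Q ^ j)
        - X * (1 - Y * x / X) * (1 - Z * x / X) *
          (qPoch (1 / x) Q j * qPoch (A * x) Q j * qPoch X Q j
            / (qPoch Q Q j * qPoch Y Q j * qPoch Z Q j) * Q ^ j))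
      = (1 - A * Q * x ^ 2) * (qPoch (1 / x) Q K * qPoch (A * (x * Q)) Q K * qPoch X Q (K + 1)
            / (qPoch Q Q K * qPoch Y Q K * qPoch Z Q K)) := by
  -- Eliminating A by the balancing condition leaves a rational identity in free variables.
  have hA : A = Y * Z / (Q * X) := by field_simp; linear_combination -hbal
  induction K with
  | zero =>
    simp only [zero_add, Finset.sum_range_one, qPoch_zero, qPoch_one, pow_zero]
    subst hA; field_simp; ring
  | succ K ih =>
    have h1' := qPoch_ne_zero_of_le h1 K.le_succ
    have h2' := qPoch_ne_zero_of_le h2 K.le_succ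
    have h3' := qPoch_ne_zero_of_le h3 K.le_succ
    rw [Finset.sum_range_succ, ih h1' h2' h3']
    rw [qPoch_succ] at h1 h2 h3
    have e1 := right_ne_zero_of_mul h1
    have e2 := right_ne_zero_of_mul h2
    have e3 := right_ne_zero_of_mul h3
    have f1 : qPoch (1 / (x * Q)) Q (K + 1) = (1 - 1 / (x * Q)) * qPoch (1 / x) Q K := by
      rw [qPoch_succ_left]; congr 2; field_simp
    have f2 : qPoch (A * x) Q (K + 1) = (1 - A * x) * qPoch (A * (x * Q)) Q K := by
      rw [qPoch_succ_left, mul_assoc]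
    rw [f1, f2, qPoch_succ X Q (K + 1), qPoch_succ X Q K, qPoch_succ Q, qPoch_succ Y,
      qPoch_succ Z, qPoch_succ (A * (x * Q)), qPoch_succ (1 / x)]
    generalize qPoch (1 / x) Q K = u1
    generalize qPoch (A * (x * Q)) Q K = u2
    generalize qPoch X Q K = u3
    generalize qPoch Q Q K = u4 at *
    generalize qPoch Y Q K = u5 at *
    generalize qPoch Z Q K = u6 at *
    rw [pow_succ Q K]
    have hJ : Q ^ K ≠ 0 := pow_ne_zero _ hQ
    generalize Q ^ K = J at *
    clear ih h1 h2 h3 f1 f2 hbal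
    subst hA
    field_simp
    ring

/-- The `q`-Pfaff–Saalschütz sum. -/
theorem saalschutz {A X Y Z Q : F} (hQ : Q ≠ 0) (hX : X ≠ 0) (hbal : Y * Z = A * Q * X)
    (k : ℕ) (h1 : qPoch Q Q k ≠ 0) (h2 : qPoch Y Q k ≠ 0) (h3 : qPoch Z Q k ≠ 0) :
    ∑ j ∈ Finset.range (k + 1),
        (qPoch (1 / Q ^ k) Q j * qPoch (A * Q ^ k) Q j * qPoch X Q j
          / (qPoch Q Q j * qPoch Y Q j * qPoch Z Q j) * Q ^ j)
      = qPoch (Y / X) Q k * qPoch (Z / X) Q k / (qPoch Y Q k * qPoch Z Q k) * X ^ k := by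
  induction k with
  | zero => simp [qPoch_zero]
  | succ k ih =>
    have h1' := qPoch_ne_zero_of_le h1 k.le_succ
    have h2' := qPoch_ne_zero_of_le h2 k.le_succ
    have h3' := qPoch_ne_zero_of_le h3 k.le_succ
    have hx : Q ^ k ≠ 0 := pow_ne_zero _ hQ
    -- At x = Q^k the telescoped sums are those of levels k + 1 and k. Summing up to k + 1 makes the
    -- boundary term vanish, because it contains (Q^(-k);Q)_{k+1} = 0.
    have key := saalschutz_telescope hx hQ hX hbal (k + 1) h1 h2 h3
    rw [Finset.sum_sub_distrib, ← Finset.mul_sum, ← Finset.mul_sum,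
      Finset.sum_range_succ (n := k + 1) (f := fun j => qPoch (1 / Q ^ k) Q j * _ * _ / _ * _),
      ih h1' h2' h3',
      qPoch_eq_zero (x := 1 / Q ^ k) (N := k) (k := k + 1) (by field_simp) k.lt_succ_self] at key
    simp only [zero_mul, zero_div, mul_zero, add_zero, ← pow_succ] at key
    rw [qPoch_succ] at h1 h2 h3
    have e2 := right_ne_zero_of_mul h2
    have e3 := right_ne_zero_of_mul h3
    have e := mul_ne_zero e2 e3
    rw [sub_eq_zero] at key
    refine mul_left_cancel₀ e (key.trans ?_)
    rw [qPoch_succ, qPoch_succ, qPoch_succ, qPoch_succ, pow_succ]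
    clear key ih e
    generalize qPoch (Y / X) Q k = u1
    generalize qPoch (Z / X) Q k = u2
    generalize qPoch Y Q k = u5 at *
    generalize qPoch Z Q k = u6 at *
    generalize Q ^ k = J at *
    have e3' : 1 - J * Z ≠ 0 := by rwa [mul_comm]
    field_simp

/-- Telescoping identity behind the recurrence in `M` of the very-well-poised `₆φ₅` sum. -/
theorem sixPhiFive_telescope {A x D E Q : F} (hx : x ≠ 0) (hQ : Q ≠ 0) (hD : D ≠ 0) (hE : E ≠ 0)
    (hA : ∀ i : ℕ, 1 - A * Q * x * Q ^ i ≠ 0)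
    (K : ℕ) (h1 : qPoch Q Q K ≠ 0) (h2 : qPoch (A * Q / D) Q K ≠ 0)
    (h3 : qPoch (A * Q / E) Q K ≠ 0) :
    ∑ m ∈ Finset.range (K + 1),
      ((1 - A * Q / D * x) * (1 - A * Q / E * x) *
          ((1 - A * Q ^ (2 * m)) * (qPoch A Q m * qPoch D Q m * qPoch E Q m * qPoch (1 / (x * Q)) Q m
            / (qPoch Q Q m * qPoch (A * Q / D) Q m * qPoch (A * Q / E) Q m
              * qPoch (A * Q * (x * Q)) Q m)) * (A * Q * (x * Q) / (D * E)) ^ m)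
        - (1 - A * Q * x) * (1 - A * Q * x / (D * E)) *
          ((1 - A * Q ^ (2 * m)) * (qPoch A Q m * qPoch D Q m * qPoch E Q m * qPoch (1 / x) Q m
            / (qPoch Q Q m * qPoch (A * Q / D) Q m * qPoch (A * Q / E) Q m
              * qPoch (A * Q * x) Q m)) * (A * Q * x / (D * E)) ^ m))
      = (1 - A * Q * x) * (qPoch A Q (K + 1) * qPoch D Q (K + 1) * qPoch E Q (K + 1)
            * qPoch (1 / x) Q K
            / (qPoch Q Q K * qPoch (A * Q / D) Q K * qPoch (A * Q / E) Q K
              * qPoch (A * Q * x) Q (K + 1)) * (A * Q * x / (D * E)) ^ (K + 1)) := by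
  induction K with
  | zero =>
    have h0 := hA 0
    simp only [zero_add, Finset.sum_range_one, qPoch_zero, qPoch_one, pow_zero, mul_zero, mul_one,
      pow_one] at h0 ⊢
    field_simp; ring
  | succ K ih =>
    have h1' := qPoch_ne_zero_of_le h1 K.le_succ
    have h2' := qPoch_ne_zero_of_le h2 K.le_succ
    have h3' := qPoch_ne_zero_of_le h3 K.le_succ
    rw [Finset.sum_range_succ, ih h1' h2' h3']
    rw [qPoch_succ] at h1 h2 h3
    have e1 := right_ne_zero_of_mul h1
    have e2 := right_ne_zero_of_mul h2
    have e3 := right_ne_zero_of_mul h3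
    have f1 : qPoch (1 / (x * Q)) Q (K + 1) = (1 - 1 / (x * Q)) * qPoch (1 / x) Q K := by
      rw [qPoch_succ_left]; congr 2; field_simp
    have a0 := hA 0
    have a1 := hA (K + 1)
    have a2 := hA K
    have f2 : qPoch (A * Q * (x * Q)) Q (K + 1)
        = qPoch (A * Q * x) Q K * (1 - A * Q * x * Q ^ K) * (1 - A * Q * x * Q ^ (K + 1))
          / (1 - A * Q * x) := by
      rw [eq_div_iff (by simpa using a0), ← qPoch_succ, ← qPoch_succ, qPoch_succ_left _ _ (K + 1),
        mul_comm, ← mul_assoc (A * Q)]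
    have a3 : qPoch (A * Q * x) Q K ≠ 0 := qPoch_ne_zero fun i _ => hA i
    rw [f1, f2, qPoch_succ (A * Q * x) Q (K + 1), qPoch_succ (A * Q * x) Q K,
      qPoch_succ A Q (K + 1), qPoch_succ A Q K, qPoch_succ D Q (K + 1), qPoch_succ D Q K,
      qPoch_succ E Q (K + 1), qPoch_succ E Q K, qPoch_succ Q, qPoch_succ (A * Q / D),
      qPoch_succ (A * Q / E), qPoch_succ (1 / x)]
    have hz : (A * Q * (x * Q) / (D * E)) ^ (K + 1)
        = (A * Q * x / (D * E)) ^ (K + 1) * (Q ^ K * Q) := by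
      rw [← pow_succ, ← mul_pow]; congr 1; field_simp
    have hm : Q ^ (2 * (K + 1)) = (Q ^ K * Q) ^ 2 := by rw [← pow_succ, ← pow_mul, mul_comm]
    rw [hz, hm, pow_succ _ (K + 1)]
    generalize (A * Q * x / (D * E)) ^ (K + 1) = zz
    generalize qPoch (1 / x) Q K = u1
    generalize qPoch A Q K = u2
    generalize qPoch D Q K = u3
    generalize qPoch E Q K = u7
    generalize qPoch Q Q K = u4 at *
    generalize qPoch (A * Q / D) Q K = u5 at *
    generalize qPoch (A * Q / E) Q K = u6 at *
    generalize qPoch (A * Q * x) Q K = u8 at *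
    rw [pow_succ] at a1
    rw [pow_succ Q K]
    rw [pow_zero, mul_one] at a0
    have hJ : Q ^ K ≠ 0 := pow_ne_zero _ hQ
    generalize Q ^ K = J at *
    clear ih h1 h2 h3 f1 f2 hz hm hA
    -- The inductive step divided by everything common to its terms. Only this identity needs the
    -- inner structure of the linear factors, which can be made opaque afterwards.
    have core : (1 - A * Q * x) * (1 - Q * J) * (1 - A * Q / D * J) * (1 - A * Q / E * J)
          * (1 - A * Q * x * (J * Q))
        + (1 - A * Q / D * x) * (1 - A * Q / E * x) * (1 - A * (J * Q) ^ 2)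
          * (1 - 1 / (x * Q)) * (1 - A * Q * x) * (J * Q)
        - (1 - A * Q * x) * (1 - A * Q * x / (D * E)) * (1 - A * (J * Q) ^ 2) * (1 - 1 / x * J)
          * (1 - A * Q * x * (J * Q))
        = (1 - A * Q * x) * (1 - A * (J * Q)) * (1 - D * (J * Q)) * (1 - E * (J * Q))
          * (1 - 1 / x * J) * (A * Q * x / (D * E)) := by
      field_simp
      ring
    generalize 1 - A * Q * x * (J * Q) = b1 at *
    generalize 1 - A * Q * x * J = b2 at *
    generalize 1 - A * Q * x = b0 at *
    generalize 1 - A * Q / D * J = c2 at *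
    generalize 1 - A * Q / E * J = c3 at *
    generalize 1 - Q * J = c1 at *
    generalize 1 - A * (J * Q) ^ 2 = w at *
    generalize 1 - A * Q / D * x = w1 at *
    generalize 1 - A * Q / E * x = w2 at *
    generalize 1 - A * Q * x / (D * E) = w3 at *
    generalize A * Q * x / (D * E) = z at *
    generalize 1 - 1 / (x * Q) = y at *
    generalize 1 - 1 / x * J = y' at *
    generalize 1 - A * (J * Q) = g1 at *
    generalize 1 - D * (J * Q) = g2 at *
    generalize 1 - E * (J * Q) = g3 at *
    generalize 1 - A * J = k1 at *
    generalize 1 - D * J = k2 at *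
    generalize 1 - E * J = k3 at *
    refine Eq.trans ?_ ((congrArg (u2 * k1 * (u3 * k2) * (u7 * k3) * u1 * zz
      / (u4 * u5 * u6 * u8 * b2 * (c1 * c2 * c3 * b1)) * ·) core).trans ?_)
    · clear core
      field_simp
      ring
    · ring

/-- The terminating very-well-poised `₆φ₅` sum. -/
theorem sixPhiFive {A D E Q : F} (hQ : Q ≠ 0) (hD : D ≠ 0) (hE : E ≠ 0)
    (hA : ∀ i : ℕ, 1 - A * Q * Q ^ i ≠ 0) (M : ℕ) (h1 : qPoch Q Q M ≠ 0)
    (h2 : qPoch (A * Q / D) Q M ≠ 0) (h3 : qPoch (A * Q / E) Q M ≠ 0) :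
    ∑ m ∈ Finset.range (M + 1),
        ((1 - A * Q ^ (2 * m)) * (qPoch A Q m * qPoch D Q m * qPoch E Q m * qPoch (1 / Q ^ M) Q m
            / (qPoch Q Q m * qPoch (A * Q / D) Q m * qPoch (A * Q / E) Q m
              * qPoch (A * Q * Q ^ M) Q m)) * (A * Q * Q ^ M / (D * E)) ^ m)
      = qPoch A Q (M + 1) * qPoch (A * Q / (D * E)) Q M
          / (qPoch (A * Q / D) Q M * qPoch (A * Q / E) Q M) := by
  induction M with
  | zero => simp [qPoch_zero, qPoch_one]
  | succ M ih =>
    have h1' := qPoch_ne_zero_of_le h1 M.le_succ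
    have h2' := qPoch_ne_zero_of_le h2 M.le_succ
    have h3' := qPoch_ne_zero_of_le h3 M.le_succ
    have hx : Q ^ M ≠ 0 := pow_ne_zero _ hQ
    have key := sixPhiFive_telescope (A := A) (D := D) (E := E) hx hQ hD hE
      (fun i => by rw [mul_assoc _ (Q ^ M), ← pow_add]; exact hA _) (M + 1) h1 h2 h3
    have z0 : qPoch (1 / Q ^ M) Q (M + 1) = 0 :=
      qPoch_eq_zero (N := M) (by field_simp) M.lt_succ_self
    rw [Finset.sum_sub_distrib, ← Finset.mul_sum, ← Finset.mul_sum,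
      Finset.sum_range_succ (n := M + 1)
        (f := fun m => _ * (_ * _ * _ * qPoch (1 / Q ^ M) Q m / _) * _),
      ih h1' h2' h3', z0] at key
    simp only [zero_mul, zero_div, mul_zero, add_zero, ← pow_succ] at key
    rw [qPoch_succ] at h2 h3
    have e2 := right_ne_zero_of_mul h2
    have e3 := right_ne_zero_of_mul h3
    have e := mul_ne_zero e2 e3
    rw [sub_eq_zero] at key
    refine mul_left_cancel₀ e (key.trans ?_)
    rw [qPoch_succ A Q (M + 1), qPoch_succ (A * Q / (D * E)), qPoch_succ (A * Q / D),
      qPoch_succ (A * Q / E), pow_succ]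
    clear key ih e z0
    rw [show 1 - A * Q / (D * E) * Q ^ M = 1 - A * Q * Q ^ M / (D * E) by ring,
      show 1 - A * (Q ^ M * Q) = 1 - A * Q * Q ^ M by ring]
    generalize qPoch (A * Q / (D * E)) Q M = u1
    generalize qPoch A Q (M + 1) = u2
    generalize qPoch (A * Q / D) Q M = u5 at *
    generalize qPoch (A * Q / E) Q M = u6 at *
    generalize 1 - A * Q / D * Q ^ M = c2 at *
    generalize 1 - A * Q / E * Q ^ M = c3 at *
    generalize 1 - A * Q * Q ^ M / (D * E) = c4
    field_simp

/-- Reversal of a `q`-shifted factorial. -/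
theorem qPoch_reverse {x y Q : F} {k : ℕ} (hQ : Q ≠ 0) (hy : y ≠ 0) (h : x * y * Q ^ k = Q) :
    qPoch x Q k = (∏ i ∈ Finset.range k, (-(1 / (y * Q ^ i)))) * qPoch y Q k := by
  unfold qPoch
  rw [← Finset.prod_range_reflect, ← Finset.prod_mul_distrib]
  refine Finset.prod_congr rfl fun i hi => ?_
  obtain ⟨l, rfl⟩ := Nat.exists_eq_add_of_lt (Finset.mem_range.1 hi)
  have h' : x * y * Q ^ i * Q ^ l = 1 := by
    have : x * y * Q ^ i * Q ^ l * Q = 1 * Q := by linear_combination h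
    exact mul_right_cancel₀ hQ this
  rw [show i + l + 1 - 1 - i = l by omega]
  have hi' : Q ^ i ≠ 0 := pow_ne_zero _ hQ
  field_simp
  linear_combination -h'

/-- Multiplying out `(Q; Q)_{j+m}` against `(Q^{-(j+m)}; Q)_j`. -/
theorem qPoch_inv_pow_div {Q : F} (hQ : Q ≠ 0) (j m : ℕ) (h : qPoch Q Q (j + m) ≠ 0) :
    qPoch (1 / Q ^ (j + m)) Q j / qPoch Q Q (j + m)
      = (∏ i ∈ Finset.range j, (-(1 / (Q * Q ^ i)))) * (1 / Q ^ j) ^ m / qPoch Q Q m := by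
  have hm : qPoch Q Q m ≠ 0 := qPoch_ne_zero_of_le h (Nat.le_add_left m j)
  have hQm : Q ^ m ≠ 0 := pow_ne_zero _ hQ
  have hQj : Q ^ j ≠ 0 := pow_ne_zero _ hQ
  rw [qPoch_reverse (y := Q * Q ^ m) hQ (mul_ne_zero hQ hQm) (by rw [pow_add]; field_simp),
    div_eq_div_iff h hm, add_comm j m, qPoch_add]
  have e : (1 / Q ^ j) ^ m = ∏ i ∈ Finset.range j, (1 / Q ^ m) := by
    rw [Finset.prod_const, Finset.card_range]; simp [← pow_mul, mul_comm]
  have e2 : ∏ i ∈ Finset.range j, (-(1 / (Q * Q ^ m * Q ^ i)))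
      = (∏ i ∈ Finset.range j, (-(1 / (Q * Q ^ i)))) * ∏ i ∈ Finset.range j, (1 / Q ^ m) := by
    rw [← Finset.prod_mul_distrib]
    refine Finset.prod_congr rfl fun i _ => ?_
    field_simp
  rw [e, e2]
  ring

/-- The inner sum in the proof of Watson's transformation. -/
theorem watson_inner {A D E Q : F} (hQ : Q ≠ 0) (hD : D ≠ 0) (hE : E ≠ 0)
    (hA : ∀ i : ℕ, 1 - A * Q * Q ^ i ≠ 0) (j M : ℕ) (h1 : qPoch Q Q (j + M) ≠ 0)
    (h2 : qPoch (A * Q / D) Q (j + M) ≠ 0) (h3 : qPoch (A * Q / E) Q (j + M) ≠ 0) :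
    ∑ m ∈ Finset.range (M + 1),
        (1 - A * Q ^ (2 * (j + m))) *
          (qPoch A Q (j + m) * qPoch D Q (j + m) * qPoch E Q (j + m)
              * qPoch (1 / Q ^ (j + M)) Q (j + m)
            / (qPoch Q Q (j + m) * qPoch (A * Q / D) Q (j + m) * qPoch (A * Q / E) Q (j + m)
              * qPoch (A * Q * Q ^ (j + M)) Q (j + m)))
          * (A * Q * Q ^ (j + M) / (D * E)) ^ (j + m)
          * (qPoch (1 / Q ^ (j + m)) Q j * qPoch (A * Q ^ (j + m)) Q j)
      = qPoch A Q (j + M + 1) / (qPoch (A * Q / D) Q (j + M) * qPoch (A * Q / E) Q (j + M))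
        * (qPoch D Q j * qPoch E Q j * qPoch (1 / Q ^ (j + M)) Q j) * qPoch (A * Q / (D * E)) Q M
        * ((∏ i ∈ Finset.range j, (-(1 / (Q * Q ^ i)))) * (A * Q * Q ^ (j + M) / (D * E)) ^ j) := by
  have hQj : Q ^ j ≠ 0 := pow_ne_zero _ hQ
  -- Shifting the summation index by j turns the inner sum into a ₆φ₅ with A, D, E replaced by A
  -- Q^(2j), D Q^j, E Q^j.
  have six := sixPhiFive (A := A * Q ^ (2 * j)) (D := D * Q ^ j) (E := E * Q ^ j) hQ
    (mul_ne_zero hD hQj) (mul_ne_zero hE hQj)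
    (fun i => by
      rw [show A * Q ^ (2 * j) * Q * Q ^ i = A * Q * Q ^ (2 * j + i) by ring]; exact hA _)
    M (qPoch_ne_zero_of_le h1 (Nat.le_add_left M j))
  have r2 : A * Q ^ (2 * j) * Q / (D * Q ^ j) = A * Q / D * Q ^ j := by field_simp; ring
  have r3 : A * Q ^ (2 * j) * Q / (E * Q ^ j) = A * Q / E * Q ^ j := by field_simp; ring
  have r4 : A * Q ^ (2 * j) * Q / (D * Q ^ j * (E * Q ^ j)) = A * Q / (D * E) := by field_simp; ring
  rw [r2, r3, r4] at six
  specialize six (qPoch_shift_ne_zero h2) (qPoch_shift_ne_zero h3)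
  have hd : ∀ k, qPoch (A * Q * Q ^ (j + M)) Q k ≠ 0 := fun k => qPoch_ne_zero fun i _ => by
    rw [mul_assoc _ (Q ^ _), ← pow_add]; exact hA _
  have hdj := hd j
  have hA1 : qPoch A Q (j + M + 1) * qPoch (A * Q * Q ^ (j + M)) Q j
      = qPoch A Q (2 * j) * qPoch (A * Q ^ (2 * j)) Q (M + 1) := by
    rw [← qPoch_add, show A * Q * Q ^ (j + M) = A * Q ^ (j + M + 1) by ring, ← qPoch_add]
    congr 1; omega
  rw [qPoch_add (A * Q / D), qPoch_add (A * Q / E)] at *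
  set P := ∏ i ∈ Finset.range j, (-(1 / (Q * Q ^ i))) with hP
  set z := A * Q * Q ^ (j + M) / (D * E) with hz
  have hterm : ∀ m ∈ Finset.range (M + 1),
      (1 - A * Q ^ (2 * (j + m))) *
          (qPoch A Q (j + m) * qPoch D Q (j + m) * qPoch E Q (j + m)
              * qPoch (1 / Q ^ (j + M)) Q (j + m)
            / (qPoch Q Q (j + m) * qPoch (A * Q / D) Q (j + m) * qPoch (A * Q / E) Q (j + m)
              * qPoch (A * Q * Q ^ (j + M)) Q (j + m)))
          * z ^ (j + m)
          * (qPoch (1 / Q ^ (j + m)) Q j * qPoch (A * Q ^ (j + m)) Q j)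
      = (qPoch A Q (2 * j) * qPoch D Q j * qPoch E Q j * qPoch (1 / Q ^ (j + M)) Q j
          / (qPoch (A * Q / D) Q j * qPoch (A * Q / E) Q j * qPoch (A * Q * Q ^ (j + M)) Q j)
          * P * z ^ j) *
        ((1 - A * Q ^ (2 * j) * Q ^ (2 * m)) *
          (qPoch (A * Q ^ (2 * j)) Q m * qPoch (D * Q ^ j) Q m * qPoch (E * Q ^ j) Q m
              * qPoch (1 / Q ^ M) Q m
            / (qPoch Q Q m * qPoch (A * Q / D * Q ^ j) Q m * qPoch (A * Q / E * Q ^ j) Q m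
              * qPoch (A * Q ^ (2 * j) * Q * Q ^ M) Q m)) *
          (A * Q ^ (2 * j) * Q * Q ^ M / (D * Q ^ j * (E * Q ^ j))) ^ m) := by
    intro m hm
    have hmM : m ≤ M := Nat.lt_succ_iff.1 (Finset.mem_range.1 hm)
    have hinv := qPoch_inv_pow_div hQ j m (qPoch_ne_zero_of_le h1 (Nat.add_le_add_left hmM j))
    have b1 : qPoch A Q (j + m) * qPoch (A * Q ^ (j + m)) Q j
        = qPoch A Q (2 * j) * qPoch (A * Q ^ (2 * j)) Q m := by
      rw [← qPoch_add, ← qPoch_add]; congr 1; omega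
    have b2 : 1 / Q ^ (j + M) * Q ^ j = 1 / Q ^ M := by rw [pow_add]; field_simp
    have b3 : A * Q * Q ^ (j + M) * Q ^ j = A * Q ^ (2 * j) * Q * Q ^ M := by ring
    have b4 : A * Q ^ (2 * j) * Q * Q ^ M / (D * Q ^ j * (E * Q ^ j)) = z * (1 / Q ^ j) := by
      rw [hz, pow_add]; field_simp; ring
    have b5 : Q ^ (2 * (j + m)) = Q ^ (2 * j) * Q ^ (2 * m) := by rw [mul_add, pow_add]
    rw [b4, mul_pow, qPoch_add D, qPoch_add E, qPoch_add (1 / Q ^ (j + M)), b2, qPoch_add (A * Q / D),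
      qPoch_add (A * Q / E), qPoch_add (A * Q * Q ^ (j + M)), b3, b5, pow_add z]
    -- Pairs (A)_{j+m} with (A Q^(j+m))_j, and (Q^(-(j+m)))_j with (Q)_{j+m}: these products split
    -- into a part depending on j and the m-th ₆φ₅ factors.
    rw [show ∀ a1 a2 a3 a4 a5 a6 a7 a8 c1 c2 c3 c4 c5 c6 c7 u v w t : F,
      w * (a1 * (a2 * a3) * (a4 * a5) * (a6 * a7) / (c1 * (c2 * c3) * (c4 * c5) * (c6 * c7)))
        * (u * v) * (t * a8) = (a1 * a8) * (t / c1) * (w * ((a2 * a3) * (a4 * a5) * (a6 * a7)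
          / ((c2 * c3) * (c4 * c5) * (c6 * c7))) * (u * v)) from fun _ _ _ _ _ _ _ _ _ _ _ _ _ _ _ _ _ _ _ => by
        ring, b1, hinv]
    ring
  rw [Finset.sum_congr rfl hterm, ← Finset.mul_sum, six]
  have g : qPoch A Q (j + M + 1) = qPoch A Q (2 * j) * qPoch (A * Q ^ (2 * j)) Q (M + 1)
      / qPoch (A * Q * Q ^ (j + M)) Q j := by rw [← hA1]; field_simp
  rw [g]
  ring

/-- Watson's transformation of a terminating very-well-poised `₈φ₇` into a balanced `₄φ₃`. -/
theorem watson {A B C D E Q : F} (hA0 : A ≠ 0) (hQ : Q ≠ 0) (hB : B ≠ 0) (hC : C ≠ 0)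
    (hD : D ≠ 0) (hE : E ≠ 0) (hA : ∀ i : ℕ, 1 - A * Q * Q ^ i ≠ 0) (N : ℕ)
    (h1 : qPoch Q Q N ≠ 0) (hB' : qPoch (A * Q / B) Q N ≠ 0) (hC' : qPoch (A * Q / C) Q N ≠ 0)
    (hD' : qPoch (A * Q / D) Q N ≠ 0) (hE' : qPoch (A * Q / E) Q N ≠ 0)
    (hR : qPoch (D * E / (A * Q ^ N)) Q N ≠ 0) :
    ∑ k ∈ Finset.range (N + 1),
        (1 - A * Q ^ (2 * k)) *
          (qPoch A Q k * qPoch B Q k * qPoch C Q k * qPoch D Q k * qPoch E Q k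
              * qPoch (1 / Q ^ N) Q k
            / (qPoch Q Q k * qPoch (A * Q / B) Q k * qPoch (A * Q / C) Q k * qPoch (A * Q / D) Q k
              * qPoch (A * Q / E) Q k * qPoch (A * Q * Q ^ N) Q k))
          * (A ^ 2 * Q ^ 2 * Q ^ N / (B * C * D * E)) ^ k
      = qPoch A Q (N + 1) * qPoch (A * Q / (D * E)) Q N
          / (qPoch (A * Q / D) Q N * qPoch (A * Q / E) Q N)
        * ∑ j ∈ Finset.range (N + 1),
          qPoch (A * Q / (B * C)) Q j * qPoch D Q j * qPoch E Q j * qPoch (1 / Q ^ N) Q j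
            / (qPoch Q Q j * qPoch (A * Q / B) Q j * qPoch (A * Q / C) Q j
              * qPoch (D * E / (A * Q ^ N)) Q j) * Q ^ j := by
  set X := A * Q / (B * C) with hXdef
  have hX : X ≠ 0 := div_ne_zero (mul_ne_zero hA0 hQ) (mul_ne_zero hB hC)
  set z := A * Q * Q ^ N / (D * E) with hz
  have hvan : ∀ k j : ℕ, k < j → qPoch (1 / Q ^ k) Q j = 0 := fun k j hkj =>
    qPoch_eq_zero (N := k) (one_div_mul_cancel (pow_ne_zero _ hQ)) hkj
  let T : ℕ → F := fun k => (1 - A * Q ^ (2 * k)) *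
          (qPoch A Q k * qPoch D Q k * qPoch E Q k * qPoch (1 / Q ^ N) Q k
            / (qPoch Q Q k * qPoch (A * Q / D) Q k * qPoch (A * Q / E) Q k
              * qPoch (A * Q * Q ^ N) Q k)) * z ^ k
  let c : ℕ → F := fun j => qPoch X Q j
    / (qPoch Q Q j * qPoch (A * Q / B) Q j * qPoch (A * Q / C) Q j) * Q ^ j
  have hterm : ∀ k ∈ Finset.range (N + 1),
      (1 - A * Q ^ (2 * k)) *
          (qPoch A Q k * qPoch B Q k * qPoch C Q k * qPoch D Q k * qPoch E Q k
              * qPoch (1 / Q ^ N) Q k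
            / (qPoch Q Q k * qPoch (A * Q / B) Q k * qPoch (A * Q / C) Q k * qPoch (A * Q / D) Q k
              * qPoch (A * Q / E) Q k * qPoch (A * Q * Q ^ N) Q k))
          * (A ^ 2 * Q ^ 2 * Q ^ N / (B * C * D * E)) ^ k
      = ∑ j ∈ Finset.range (N + 1), c j * (T k * (qPoch (1 / Q ^ k) Q j * qPoch (A * Q ^ k) Q j)) := by
    intro k hk
    have hkN : k ≤ N := Nat.lt_succ_iff.1 (Finset.mem_range.1 hk)
    -- Saalschütz read backwards: the B, C part of the k-th term becomes a sum over j, after which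
    -- the order of summation can be exchanged.
    have hs := saalschutz (A := A) (X := X) (Y := A * Q / B) (Z := A * Q / C) hQ hX
      (by rw [hXdef]; field_simp) k (qPoch_ne_zero_of_le h1 hkN) (qPoch_ne_zero_of_le hB' hkN)
      (qPoch_ne_zero_of_le hC' hkN)
    rw [show A * Q / B / X = C by rw [hXdef]; field_simp,
      show A * Q / C / X = B by rw [hXdef]; field_simp] at hs
    have hw : A ^ 2 * Q ^ 2 * Q ^ N / (B * C * D * E) = z * X := by
      rw [hz, hXdef]; field_simp
    have hsplit : ∑ j ∈ Finset.range (N + 1),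
          c j * (T k * (qPoch (1 / Q ^ k) Q j * qPoch (A * Q ^ k) Q j))
        = T k * ∑ j ∈ Finset.range (k + 1),
          (qPoch (1 / Q ^ k) Q j * qPoch (A * Q ^ k) Q j * qPoch X Q j
          / (qPoch Q Q j * qPoch (A * Q / B) Q j * qPoch (A * Q / C) Q j) * Q ^ j) := by
      rw [Finset.mul_sum]
      symm
      refine (Finset.sum_congr rfl fun j _ => ?_).trans
        (Finset.sum_subset (Finset.range_mono (Nat.succ_le_succ hkN)) fun j _ hj => ?_)
      · simp only [c]; ring
      · rw [Finset.mem_range, not_lt] at hj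
        rw [hvan k j hj, zero_mul, mul_zero, mul_zero]
    rw [hsplit, hs, hw, mul_pow]
    simp only [T]
    ring
  have cancel : ∀ a y u p r x d e f q1 q2 q3 w : F, r ≠ 0 →
      x / (q1 * q2 * q3) * w * (a / y * (d * e * f) * u * p)
        = a * (u * (p * r)) / y * (x * d * e * f / (q1 * q2 * q3 * r) * w) := by
    intro a y u p r x d e f q1 q2 q3 w hr
    rw [show a * (u * (p * r)) / y * (x * d * e * f / (q1 * q2 * q3 * r) * w)
      = x / (q1 * q2 * q3) * w * (a / y * (d * e * f) * u * p) * (r * r⁻¹) by ring,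
      mul_inv_cancel₀ hr, mul_one]
  rw [Finset.sum_congr rfl hterm, Finset.sum_comm, Finset.mul_sum]
  refine Finset.sum_congr rfl fun j hj => ?_
  obtain ⟨M, rfl⟩ := Nat.exists_eq_add_of_le (Nat.lt_succ_iff.1 (Finset.mem_range.1 hj))
  -- Terms with k < j vanish since (Q^(-k);Q)_j = 0; the rest is indexed by k = j + m.
  rw [← Finset.mul_sum, add_assoc j M 1, Finset.sum_range_add, Finset.sum_eq_zero, zero_add]
  · simp only [T]
    rw [hz, watson_inner hQ hD hE hA j M h1 hD' hE', ← hz]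
    have hQN : Q ^ (j + M) ≠ 0 := pow_ne_zero _ hQ
    -- Reversal converts the top j factors of (AQ/(DE);Q)_N into the ₄φ₃ denominator (DE/(A
    -- Q^N);Q)_j.
    have hrev := qPoch_reverse (x := A * Q / (D * E) * Q ^ M) (y := D * E / (A * Q ^ (j + M)))
      (k := j) hQ (div_ne_zero (mul_ne_zero hD hE) (mul_ne_zero hA0 hQN))
      (by rw [pow_add]; field_simp)
    have hRj := qPoch_ne_zero_of_le hR (Nat.le_add_right j M)
    have hprod : (∏ i ∈ Finset.range j, (-(1 / (Q * Q ^ i)))) * z ^ j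
        = ∏ i ∈ Finset.range j, (-(1 / (D * E / (A * Q ^ (j + M)) * Q ^ i))) := by
      rw [← Finset.card_range j, ← Finset.prod_const, Finset.card_range, ← Finset.prod_mul_distrib]
      refine Finset.prod_congr rfl fun i _ => ?_
      rw [hz]; field_simp
    rw [hprod, add_comm j M, qPoch_add (A * Q / (D * E)), hrev, add_comm M j, add_assoc]
    exact cancel _ _ _ _ _ _ _ _ _ _ _ _ _ hRj
  · intro k hk
    rw [hvan k j (Finset.mem_range.1 hk), zero_mul, mul_zero]

end QSeries

/-! ### Cancellation of the terms k and N - k when q^n = 1. -/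

section Reversal

variable {F : Type*} [Field F]

/-- Both sides equal (qx;q^4)_{i+k}: when q^(4(i+k)+1) = 1, its last k (or i) factors reverse into
factors of (q^4/x;q^4). This compares the i-th and k-th ratios (qx)/(q^4/x). -/
theorem qPoch_ratio_reverse {q x : F} (hq : q ≠ 0) (hx : x ≠ 0) {i k : ℕ}
    (h : q ^ (4 * (i + k) + 1) = 1) :
    qPoch (q * x) (q ^ 4) i * qPoch (q ^ 4 / x) (q ^ 4) k
        * ((-x) ^ k * ∏ l ∈ Finset.range k, (1 / (q ^ 4 * (q ^ 4) ^ l)))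
      = qPoch (q * x) (q ^ 4) k * qPoch (q ^ 4 / x) (q ^ 4) i
        * ((-x) ^ i * ∏ l ∈ Finset.range i, (1 / (q ^ 4 * (q ^ 4) ^ l))) := by
  have hQ : q ^ 4 ≠ 0 := pow_ne_zero _ hq
  have key : ∀ i k : ℕ, q ^ (4 * (i + k) + 1) = 1 →
      qPoch (q * x) (q ^ 4) i * qPoch (q ^ 4 / x) (q ^ 4) k
        * ((-x) ^ k * ∏ l ∈ Finset.range k, (1 / (q ^ 4 * (q ^ 4) ^ l)))
      = qPoch (q * x) (q ^ 4) (i + k) := by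
    intro i k h
    have h' : q * (q ^ 4) ^ (i + k) = 1 := by rw [← h, ← pow_mul]; ring
    rw [qPoch_add, qPoch_reverse (x := q * x * (q ^ 4) ^ i) (y := q ^ 4 / x) hQ
      (div_ne_zero hQ hx)]
    · have e : ∏ l ∈ Finset.range k, (-(1 / (q ^ 4 / x * (q ^ 4) ^ l)))
          = (-x) ^ k * ∏ l ∈ Finset.range k, (1 / (q ^ 4 * (q ^ 4) ^ l)) := by
        rw [← Finset.card_range k, ← Finset.prod_const, Finset.card_range,
          ← Finset.prod_mul_distrib]
        refine Finset.prod_congr rfl fun l _ => ?_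
        field_simp
      rw [e]; ring
    · rw [show q * x * (q ^ 4) ^ i * (q ^ 4 / x) * (q ^ 4) ^ k
        = q * (q ^ 4) ^ (i + k) * q ^ 4 * (x / x) by rw [pow_add]; ring, h', div_self hx]
      ring
  rw [key i k h, key k i (by rwa [add_comm k]), add_comm]

/-- The product is q^(-2k(k+1)); the sixth power arises because each term of the sum contains six
ratios. -/
theorem prod_inv_pow_six {q : F} (hq : q ≠ 0) (k : ℕ) :
    (∏ l ∈ Finset.range k, (1 / (q ^ 4 * (q ^ 4) ^ l))) ^ 6 * q ^ (12 * k * (k + 1)) = 1 := by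
  induction k with
  | zero => simp
  | succ k ih =>
    rw [Finset.prod_range_succ, mul_pow,
      show q ^ (12 * (k + 1) * (k + 1 + 1))
        = q ^ (12 * k * (k + 1)) * (q ^ 4 * (q ^ 4) ^ k) ^ 6 by ring]
    have : q ^ 4 * (q ^ 4) ^ k ≠ 0 := mul_ne_zero (pow_ne_zero _ hq) (pow_ne_zero _ (pow_ne_zero _ hq))
    rw [show ∀ a b c d : F, a * b * (c * d) = a * c * (b * d) from fun a b c d => by ring, ih,
      ← mul_pow, one_div_mul_cancel this]
    simp

theorem root_of_unity_weight_antisymm {q : F} (hq : q ≠ 0) {i k : ℕ}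
    (h : q ^ (4 * (i + k) + 1) = 1) :
    (1 - q ^ (8 * i + 1)) * q ^ (5 * i) * q ^ (12 * k * (k + 1))
      = -((1 - q ^ (8 * k + 1)) * q ^ (5 * k) * q ^ (12 * i * (i + 1))) := by
  have key : ∀ i k : ℕ, q ^ (4 * (i + k) + 1) = 1 →
      q ^ (5 * i + 12 * k * (k + 1)) = q ^ (8 * k + 1 + 5 * k + 12 * i * (i + 1)) := by
    intro i k h
    rw [← zpow_natCast, ← zpow_natCast,
      -- The two exponents differ by a multiple of n = 4(i+k) + 1. Hence the summand 1 on one side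
      -- matches q^(8k+1) on the other, which gives the sign change.
      show ((5 * i + 12 * k * (k + 1) : ℕ) : ℤ) = ((8 * k + 1 + 5 * k + 12 * i * (i + 1) : ℕ) : ℤ)
        + ((4 * (i + k) + 1 : ℕ) : ℤ) * (3 * ((k : ℤ) - i) - 1) by push_cast; ring,
      zpow_add₀ hq, zpow_mul, zpow_natCast q (4 * (i + k) + 1), h, one_zpow, mul_one]
  have h1 := key i k h
  have h2 := key k i (by rwa [add_comm k])
  simp only [pow_add, pow_one] at h1 h2 ⊢
  linear_combination h1 + h2

/-- The truncated very-well-poised sum with an extra parameter `b` vanishes at roots of unity. -/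
theorem sum_eq_zero_of_root_of_unity {q a b c d : F} (h2 : (2 : F) ≠ 0) (hq : q ≠ 0) (ha : a ≠ 0)
    (hb : b ≠ 0) (hc : c ≠ 0) (hd : d ≠ 0) {N : ℕ} (h : q ^ (4 * N + 1) = 1)
    (d1 : qPoch (q ^ 4) (q ^ 4) N ≠ 0) (d2 : qPoch (q ^ 4 * b) (q ^ 4) N ≠ 0)
    (d3 : qPoch (q ^ 4 / c) (q ^ 4) N ≠ 0) (d4 : qPoch (q ^ 4 / d) (q ^ 4) N ≠ 0)
    (d5 : qPoch (q ^ 4 * a) (q ^ 4) N ≠ 0) (d6 : qPoch (q ^ 4 / a) (q ^ 4) N ≠ 0) :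
    ∑ k ∈ Finset.range (N + 1),
      (1 - q ^ (8 * k + 1))
      * ((qPoch q (q ^ 4) k * qPoch (q / b) (q ^ 4) k * qPoch (c * q) (q ^ 4) k
            * qPoch (d * q) (q ^ 4) k * qPoch (q * a) (q ^ 4) k * qPoch (q / a) (q ^ 4) k)
          / (qPoch (q ^ 4) (q ^ 4) k * qPoch (q ^ 4 * b) (q ^ 4) k * qPoch (q ^ 4 / c) (q ^ 4) k
            * qPoch (q ^ 4 / d) (q ^ 4) k
            * qPoch (q ^ 4 * a) (q ^ 4) k * qPoch (q ^ 4 / a) (q ^ 4) k))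
      * (b / (c * d)) ^ k * q ^ (5 * k) = 0 := by
  set T : ℕ → F := fun k => (1 - q ^ (8 * k + 1))
      * ((qPoch q (q ^ 4) k * qPoch (q / b) (q ^ 4) k * qPoch (c * q) (q ^ 4) k
            * qPoch (d * q) (q ^ 4) k * qPoch (q * a) (q ^ 4) k * qPoch (q / a) (q ^ 4) k)
          / (qPoch (q ^ 4) (q ^ 4) k * qPoch (q ^ 4 * b) (q ^ 4) k * qPoch (q ^ 4 / c) (q ^ 4) k
            * qPoch (q ^ 4 / d) (q ^ 4) k
            * qPoch (q ^ 4 * a) (q ^ 4) k * qPoch (q ^ 4 / a) (q ^ 4) k))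
      * (b / (c * d)) ^ k * q ^ (5 * k) with hT
  have anti : ∀ i k : ℕ, i + k = N → T i = -T k := by
    intro i k hik
    subst hik
    have hi := Nat.le_add_right i k
    have hk := Nat.le_add_left k i
    have r1 := qPoch_ratio_reverse hq one_ne_zero h
    have r2 := qPoch_ratio_reverse hq (inv_ne_zero hb) h
    have r3 := qPoch_ratio_reverse hq hc h
    have r4 := qPoch_ratio_reverse hq hd h
    have r5 := qPoch_ratio_reverse hq ha h
    have r6 := qPoch_ratio_reverse hq (inv_ne_zero ha) h
    have w := root_of_unity_weight_antisymm hq h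
    have pi := prod_inv_pow_six hq i
    have pk := prod_inv_pow_six hq k
    have n1 := qPoch_ne_zero_of_le d1 hi
    have n2 := qPoch_ne_zero_of_le d2 hi
    have n3 := qPoch_ne_zero_of_le d3 hi
    have n4 := qPoch_ne_zero_of_le d4 hi
    have n5 := qPoch_ne_zero_of_le d5 hi
    have n6 := qPoch_ne_zero_of_le d6 hi
    have m1 := qPoch_ne_zero_of_le d1 hk
    have m2 := qPoch_ne_zero_of_le d2 hk
    have m3 := qPoch_ne_zero_of_le d3 hk
    have m4 := qPoch_ne_zero_of_le d4 hk
    have m5 := qPoch_ne_zero_of_le d5 hk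
    have m6 := qPoch_ne_zero_of_le d6 hk
    simp only [mul_one, div_one, ← div_eq_mul_inv, div_inv_eq_mul, mul_comm q c, mul_comm q d]
      at r1 r2 r3 r4 r5 r6
    set gi := ∏ l ∈ Finset.range i, (1 / (q ^ 4 * (q ^ 4) ^ l))
    set gk := ∏ l ∈ Finset.range k, (1 / (q ^ 4 * (q ^ 4) ^ l))
    -- The six reversals contribute powers of -x for x = 1, 1/b, c, d, a, 1/a; the weight (b/(cd))^m
    -- cancels them exactly.
    have hpow : ∀ m : ℕ, (-1) ^ m * (-b⁻¹) ^ m * (-c) ^ m * (-d) ^ m * (-a) ^ m * (-a⁻¹) ^ m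
        * (b / (c * d)) ^ m = (1 : F) := by
      intro m
      rw [← mul_pow, ← mul_pow, ← mul_pow, ← mul_pow, ← mul_pow, ← mul_pow]
      convert one_pow m using 2
      field_simp
    have pwi := hpow i
    have pwk := hpow k
    have hUi : q ^ (12 * i * (i + 1)) ≠ 0 := pow_ne_zero _ hq
    have hUk : q ^ (12 * k * (k + 1)) ≠ 0 := pow_ne_zero _ hq
    simp only [hT]
    generalize q ^ (12 * i * (i + 1)) = Ui at *
    generalize q ^ (12 * k * (k + 1)) = Uk at *
    generalize (b / (c * d)) ^ i = si at *
    generalize (b / (c * d)) ^ k = sk at *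
    set Ni := qPoch q (q ^ 4) i * qPoch (q / b) (q ^ 4) i * qPoch (c * q) (q ^ 4) i
            * qPoch (d * q) (q ^ 4) i * qPoch (q * a) (q ^ 4) i * qPoch (q / a) (q ^ 4) i with hNi
    set Nk := qPoch q (q ^ 4) k * qPoch (q / b) (q ^ 4) k * qPoch (c * q) (q ^ 4) k
            * qPoch (d * q) (q ^ 4) k * qPoch (q * a) (q ^ 4) k * qPoch (q / a) (q ^ 4) k with hNk
    have hDi0 := mul_ne_zero (mul_ne_zero (mul_ne_zero (mul_ne_zero (mul_ne_zero n1 n2) n3) n4) n5) n6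
    have hDk0 := mul_ne_zero (mul_ne_zero (mul_ne_zero (mul_ne_zero (mul_ne_zero m1 m2) m3) m4) m5) m6
    set Di := qPoch (q ^ 4) (q ^ 4) i * qPoch (q ^ 4 * b) (q ^ 4) i * qPoch (q ^ 4 / c) (q ^ 4) i
      * qPoch (q ^ 4 / d) (q ^ 4) i * qPoch (q ^ 4 * a) (q ^ 4) i * qPoch (q ^ 4 / a) (q ^ 4) i
      with hDi
    set Dk := qPoch (q ^ 4) (q ^ 4) k * qPoch (q ^ 4 * b) (q ^ 4) k * qPoch (q ^ 4 / c) (q ^ 4) k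
      * qPoch (q ^ 4 / d) (q ^ 4) k * qPoch (q ^ 4 * a) (q ^ 4) k * qPoch (q ^ 4 / a) (q ^ 4) k
      with hDk
    set Ri := (-1) ^ i * (-b⁻¹) ^ i * (-c) ^ i * (-d) ^ i * (-a) ^ i * (-a⁻¹) ^ i with hRi
    set Rk := (-1) ^ k * (-b⁻¹) ^ k * (-c) ^ k * (-d) ^ k * (-a) ^ k * (-a⁻¹) ^ k with hRk
    have prod : Ni * Dk * (Rk * gk ^ 6) = Nk * Di * (Ri * gi ^ 6) := by
      have := congrArg₂ (· * ·) (congrArg₂ (· * ·) (congrArg₂ (· * ·) (congrArg₂ (· * ·)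
        (congrArg₂ (· * ·) r1 r2) r3) r4) r5) r6
      refine Eq.trans ?_ (this.trans ?_)
      · rw [hNi, hDk, hRk]; ring
      · rw [hNk, hDi, hRi]; ring
    clear_value Ni Nk Di Dk Ri Rk gi gk
    have prod' : Ni * Dk * Ui * si = Nk * Di * Uk * sk := by
      have : Ni * Dk * Ui * si * ((gk ^ 6 * Uk) * (Rk * sk))
          = Nk * Di * Uk * sk * ((gi ^ 6 * Ui) * (Ri * si)) := by
        linear_combination Ui * Uk * si * sk * prod
      rwa [pi, pk, pwi, pwk, mul_one, mul_one, mul_one] at this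
    rw [mul_div_assoc', div_mul_eq_mul_div, div_mul_eq_mul_div, mul_div_assoc', div_mul_eq_mul_div,
      div_mul_eq_mul_div, ← neg_div, div_eq_div_iff hDi0 hDk0]
    refine mul_left_cancel₀ (mul_ne_zero hUi hUk) ?_
    linear_combination (Ni * Dk * Ui * si) * w
      - ((1 - q ^ (8 * k + 1)) * q ^ (5 * k) * Ui) * prod'
  have hrefl := Finset.sum_range_reflect T (N + 1)
  have : ∑ k ∈ Finset.range (N + 1), T k = -∑ k ∈ Finset.range (N + 1), T k := by
    nth_rw 1 [← hrefl]
    rw [← Finset.sum_neg_distrib]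
    refine Finset.sum_congr rfl fun k hk => anti _ _ ?_
    have := Finset.mem_range.1 hk
    omega
  have h0 : 2 * ∑ k ∈ Finset.range (N + 1), T k = 0 := by linear_combination this
  exact (mul_eq_zero.1 h0).resolve_left h2

end Reversal

/-! ### The deformed sum and the two applications of Watson's transformation. -/

section Evaluations

variable {F : Type*} [Field F]

/-- Values of `q, a, c, d` at which no denominator of the two sums vanishes. -/
structure Nondegenerate (N : ℕ) (q a c d : F) : Prop where
  q_ne : q ≠ 0
  a_ne : a ≠ 0
  c_ne : c ≠ 0
  d_ne : d ≠ 0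
  q_pow : ∀ i, 0 < i → i ≤ 4 * N → q ^ i ≠ 1
  q_one : q ≠ 1
  a_pow : a ^ (4 * N + 1) ≠ 1
  a_shift : ∀ j < N, a ≠ q ^ (4 * j + 4) ∧ a * q ^ (4 * j + 4) ≠ 1
  c_shift : ∀ j, c ≠ q ^ j
  d_shift : ∀ j, d ≠ q ^ j

namespace Nondegenerate

variable {N : ℕ} {q a c d : F} (h : Nondegenerate N q a c d)
include h

theorem a_one : 1 - a ≠ 0 := fun h0 => h.a_pow (by rw [← sub_eq_zero.1 h0, one_pow])

theorem one_sub_q : 1 - q ≠ 0 := fun h0 => h.q_one (sub_eq_zero.1 h0).symm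

theorem qPoch_pow_ne {m k : ℕ} (hm : 0 < m) (hm4 : m ≤ 4) (hk : k ≤ N) :
    qPoch (q ^ m) (q ^ 4) k ≠ 0 :=
  qPoch_ne_zero fun i hi => by
    rw [← pow_mul, ← pow_add]
    exact fun h0 => h.q_pow _ (by omega) (by omega) (sub_eq_zero.1 h0).symm

theorem qPoch_c_ne (k : ℕ) : qPoch (q ^ 4 / c) (q ^ 4) k ≠ 0 :=
  qPoch_ne_zero fun i _ h0 => h.c_shift (4 + 4 * i) (by
    have := h.c_ne
    rw [pow_add, pow_mul]
    field_simp at h0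
    linear_combination h0)

theorem qPoch_d_ne (k : ℕ) : qPoch (q ^ 4 / d) (q ^ 4) k ≠ 0 :=
  qPoch_ne_zero fun i _ h0 => h.d_shift (4 + 4 * i) (by
    have := h.d_ne
    rw [pow_add, pow_mul]
    field_simp at h0
    linear_combination h0)

theorem qPoch_a_ne {k : ℕ} (hk : k ≤ N) : qPoch (q ^ 4 * a) (q ^ 4) k ≠ 0 :=
  qPoch_ne_zero fun i hi h0 => (h.a_shift i (by omega)).2 (by
    rw [pow_add, pow_mul]
    linear_combination -h0)

theorem qPoch_a_inv_ne {k : ℕ} (hk : k ≤ N) : qPoch (q ^ 4 / a) (q ^ 4) k ≠ 0 :=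
  qPoch_ne_zero fun i hi h0 => (h.a_shift i (by omega)).1 (by
    have := h.a_ne
    rw [pow_add, pow_mul]
    field_simp at h0
    linear_combination h0)

end Nondegenerate

/-- The left-hand sum with one of the parameters `q` deformed to `q / b`. -/
def deformedSum (N : ℕ) (q a b c d : F) : F :=
  ∑ k ∈ Finset.range (N + 1),
    qInt q (8 * k + 1)
      * ((qPoch q (q ^ 4) k * qPoch (q / b) (q ^ 4) k * qPoch (c * q) (q ^ 4) k
            * qPoch (d * q) (q ^ 4) k * qPoch (q * a) (q ^ 4) k * qPoch (q / a) (q ^ 4) k)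
          / (qPoch (q ^ 4) (q ^ 4) k * qPoch (q ^ 4 * b) (q ^ 4) k * qPoch (q ^ 4 / c) (q ^ 4) k
            * qPoch (q ^ 4 / d) (q ^ 4) k
            * qPoch (q ^ 4 * a) (q ^ 4) k * qPoch (q ^ 4 / a) (q ^ 4) k))
      * (b / (c * d)) ^ k * q ^ (5 * k)

theorem lhsSum_eq_deformedSum (N : ℕ) (q a c d : F) :
    lhsSum (4 * N + 1) q a c d = deformedSum N q a 1 c d := by
  unfold lhsSum deformedSum
  rw [show (4 * N + 1 - 1) / 4 = N by omega]
  refine Finset.sum_congr rfl fun k _ => ?_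
  rw [div_one, mul_one, zpow_neg, zpow_natCast, one_div, inv_pow, sq, sq]

theorem deformedSum_eq_zero_of_root_of_unity {N : ℕ} {q a b c d : F} (h : Nondegenerate N q a c d)
    (h2 : (2 : F) ≠ 0) (hb : b ≠ 0) (hb' : qPoch (q ^ 4 * b) (q ^ 4) N ≠ 0)
    (hq : q ^ (4 * N + 1) = 1) : deformedSum N q a b c d = 0 := by
  have := sum_eq_zero_of_root_of_unity h2 h.q_ne h.a_ne hb h.c_ne h.d_ne hq
    (h.qPoch_pow_ne (m := 4) (by norm_num) le_rfl le_rfl) hb' (h.qPoch_c_ne N) (h.qPoch_d_ne N)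
    (h.qPoch_a_ne le_rfl) (h.qPoch_a_inv_ne le_rfl)
  rw [← zero_div (1 - q), ← this, Finset.sum_div]
  unfold deformedSum qInt
  exact Finset.sum_congr rfl fun k _ => by ring

/-- The factor of the transformed sum at `b = q ^ n`, without `[n]`. -/
def deformedFactor (N : ℕ) (q a : F) : F :=
  qPoch q (q ^ 4) N * qPoch (q ^ 3) (q ^ 4) N
    / (qPoch (q ^ 4 / a) (q ^ 4) N * qPoch (q ^ 4 * a) (q ^ 4) N)

/-- The right-hand sum with a pair of parameters deformed; `b = 1` gives back `rhsSum`. -/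
def deformedRhsSum (N : ℕ) (q a b c d : F) : F :=
  ∑ k ∈ Finset.range (N + 1),
    (qPoch (q / b) (q ^ 4) k * qPoch (q ^ 3 / (c * d)) (q ^ 4) k
        * qPoch (a * q) (q ^ 4) k * qPoch (q / a) (q ^ 4) k)
      / (qPoch (q ^ 2 / b) (q ^ 4) k * qPoch (q ^ 4) (q ^ 4) k
        * qPoch (q ^ 4 / c) (q ^ 4) k * qPoch (q ^ 4 / d) (q ^ 4) k)
      * q ^ (4 * k)

theorem rhsSum_eq_deformedRhsSum (N : ℕ) (q a c d : F) :
    rhsSum (4 * N + 1) q a c d = deformedRhsSum N q a 1 c d := by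
  unfold rhsSum deformedRhsSum
  rw [show (4 * N + 1 - 1) / 4 = N by omega]
  simp only [div_one]

theorem one_sub_shift_ne {q : F} (hq : ∀ i, 0 < i → q ^ i ≠ 1) (i : ℕ) :
    1 - q * q ^ 4 * (q ^ 4) ^ i ≠ 0 := fun h0 =>
  hq (4 * i + 5) (by omega) (by rw [pow_add, pow_mul]; linear_combination -h0)

/-- The factors are 1 - q^(-m) with m = 4(N-i) - 1 strictly between 0 and 4N, so nondegeneracy in
this range suffices. -/
theorem qPoch_sq_div_ne {N : ℕ} {q a c d : F} (h : Nondegenerate N q a c d) :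
    qPoch (q ^ 2 / q ^ (4 * N + 1)) (q ^ 4) N ≠ 0 :=
  qPoch_ne_zero fun i hi h0 => h.q_pow (4 * (N - i) - 1) (by omega) (by omega) (by
    have hq := h.q_ne
    obtain ⟨m, rfl⟩ := Nat.exists_eq_add_of_lt hi
    have e : 4 * (i + m + 1 - i) - 1 = 4 * m + 3 := by omega
    rw [e]
    rw [div_mul_eq_mul_div, sub_eq_zero, eq_div_iff (pow_ne_zero _ hq), one_mul] at h0
    have : q ^ (4 * i + 2) * q ^ (4 * m + 3) = q ^ (4 * i + 2) * 1 := by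
      rw [mul_one, ← pow_add]
      refine Eq.trans ?_ (h0.trans ?_)
      · congr 1; omega
      · rw [← pow_mul, ← pow_add]; congr 1; omega
    exact mul_left_cancel₀ (pow_ne_zero _ hq) this)

theorem qInt_mul_eq {q : F} (hq : 1 - q ≠ 0) (N : ℕ) :
    qPoch q (q ^ 4) (N + 1) = qPoch q (q ^ 4) N * ((1 - q) * qInt q (4 * N + 1)) := by
  rw [qPoch_succ, qInt, mul_div_cancel₀ _ hq]; ring

theorem deformedSum_eq_of_eq_pow {N : ℕ} {q a c d : F} (h : Nondegenerate N q a c d)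
    (hq : ∀ i, 0 < i → q ^ i ≠ 1) :
    deformedSum N q a (q ^ (4 * N + 1)) c d
      = qInt q (4 * N + 1)
        * (deformedFactor N q a * deformedRhsSum N q a (q ^ (4 * N + 1)) c d) := by
  have hq0 := h.q_ne
  have ha0 := h.a_ne
  have hc0 := h.c_ne
  have hd0 := h.d_ne
  have h1q := h.one_sub_q
  have hQN : q ^ (4 * N) ≠ 0 := pow_ne_zero _ hq0
  have a1 : q * q ^ 4 / (c * q) = q ^ 4 / c := by field_simp
  have a2 : q * q ^ 4 / (d * q) = q ^ 4 / d := by field_simp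
  have a3 : q * q ^ 4 / (q * a) = q ^ 4 / a := by field_simp
  have a4 : q * q ^ 4 / (q / a) = q ^ 4 * a := by field_simp
  have a5 : q * a * (q / a) / (q * (q ^ 4) ^ N) = q ^ 2 / q ^ (4 * N + 1) := by
    rw [← pow_mul, pow_succ]; field_simp; ring
  have a6 : (1 : F) / (q ^ 4) ^ N = q / q ^ (4 * N + 1) := by
    rw [← pow_mul, pow_succ]; field_simp
  have a7 : q * q ^ 4 * (q ^ 4) ^ N = q ^ 4 * q ^ (4 * N + 1) := by ring
  have a8 : q ^ 2 * (q ^ 4) ^ 2 * (q ^ 4) ^ N / (c * q * (d * q) * (q * a) * (q / a))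
      = q ^ (4 * N + 1) / (c * d) * q ^ 5 := by
    rw [← pow_mul q 4 N, pow_succ]; field_simp; ring
  have a9 : q * q ^ 4 / (q * a * (q / a)) = q ^ 3 := by field_simp
  have a10 : q * q ^ 4 / (c * q * (d * q)) = q ^ 3 / (c * d) := by field_simp
  -- At b = q^n the deformed parameter q/b is (q^4)^(-N), the terminating one; a and 1/a occupy the
  -- slots D and E.
  have w := watson (A := q) (B := c * q) (C := d * q) (D := q * a) (E := q / a) (Q := q ^ 4)
    hq0 (pow_ne_zero _ hq0) (mul_ne_zero hc0 hq0) (mul_ne_zero hd0 hq0) (mul_ne_zero hq0 ha0)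
    (div_ne_zero hq0 ha0) (one_sub_shift_ne hq) N
    (h.qPoch_pow_ne (m := 4) (by norm_num) le_rfl le_rfl)
    (by rw [a1]; exact h.qPoch_c_ne N) (by rw [a2]; exact h.qPoch_d_ne N)
    (by rw [a3]; exact h.qPoch_a_inv_ne le_rfl) (by rw [a4]; exact h.qPoch_a_ne le_rfl)
    (by rw [a5]; exact qPoch_sq_div_ne h)
  rw [a1, a2, a3, a4, a5, a6, a7, a8, a9, a10, qInt_mul_eq h1q] at w
  refine mul_left_cancel₀ h1q (Eq.trans ?_ (w.trans ?_))
  · rw [deformedSum, Finset.mul_sum]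
    refine Finset.sum_congr rfl fun k _ => ?_
    have e : (1 - q) * qInt q (8 * k + 1) = 1 - q * (q ^ 4) ^ (2 * k) := by
      rw [qInt, mul_div_cancel₀ _ h1q]; ring
    rw [← mul_assoc, ← mul_assoc, ← mul_assoc, e, mul_pow, ← pow_mul]
    ring
  · rw [deformedRhsSum, deformedFactor]
    rw [show ∀ s t : F, (1 - q) * (qInt q (4 * N + 1) * (t * s)) = (1 - q) * qInt q (4 * N + 1) * t * s
      from fun s t => by ring]
    congr 1
    · ring
    · refine Finset.sum_congr rfl fun k _ => ?_
      rw [← pow_mul, mul_comm q a]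
      ring

theorem lhsSum_eq_of_eq_pow {N : ℕ} {q a c d : F} (h : Nondegenerate N q a c d)
    (hq : ∀ i, 0 < i → q ^ i ≠ 1) (ha : a = q ^ (4 * N + 1)) :
    lhsSum (4 * N + 1) q a c d
      = (q ^ N)⁻¹ * qInt q (4 * N + 1) * (qPoch (q ^ 2) (q ^ 4) N / qPoch (q ^ 4) (q ^ 4) N)
        * rhsSum (4 * N + 1) q a c d := by
  have hq0 := h.q_ne
  have ha0 := h.a_ne
  have hc0 := h.c_ne
  have hd0 := h.d_ne
  have h1q := h.one_sub_q
  have hQ0 : q ^ 4 ≠ 0 := pow_ne_zero _ hq0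
  have hQN : q ^ (4 * N) ≠ 0 := pow_ne_zero _ hq0
  have a1 : q * q ^ 4 / (c * q) = q ^ 4 / c := by field_simp
  have a2 : q * q ^ 4 / (d * q) = q ^ 4 / d := by field_simp
  have a3 : q * q ^ 4 / (q * a) = q ^ 4 / a := by field_simp
  have a4 : q * q ^ 4 / q = q ^ 4 := by field_simp
  have a5 : q * a * q / (q * (q ^ 4) ^ N) = q ^ 2 := by
    rw [ha, ← pow_mul, pow_succ]; field_simp
  have a6 : (1 : F) / (q ^ 4) ^ N = q / a := by
    rw [ha, ← pow_mul, pow_succ]; field_simp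
  have a7 : q * q ^ 4 * (q ^ 4) ^ N = q ^ 4 * a := by rw [ha]; ring
  have a8 : q ^ 2 * (q ^ 4) ^ 2 * (q ^ 4) ^ N / (c * q * (d * q) * (q * a) * q)
      = 1 / (c * d) * q ^ 5 := by
    rw [ha, ← pow_mul q 4 N, pow_succ]; field_simp; ring
  have a9 : q * q ^ 4 / (q * a * q) = q ^ 3 / a := by field_simp
  have a10 : q * q ^ 4 / (c * q * (d * q)) = q ^ 3 / (c * d) := by field_simp
  have hp4 := h.qPoch_pow_ne (m := 4) (k := N) (by norm_num) le_rfl le_rfl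
  have hp1 := h.qPoch_pow_ne (m := 1) (k := N) (by norm_num) (by norm_num) le_rfl
  rw [pow_one] at hp1
  -- Here q/a is the terminating parameter (q^4)^(-N), and the undeformed second q takes the slot E.
  have w := watson (A := q) (B := c * q) (C := d * q) (D := q * a) (E := q) (Q := q ^ 4)
    hq0 (pow_ne_zero _ hq0) (mul_ne_zero hc0 hq0) (mul_ne_zero hd0 hq0) (mul_ne_zero hq0 ha0)
    hq0 (one_sub_shift_ne hq) N hp4
    (by rw [a1]; exact h.qPoch_c_ne N) (by rw [a2]; exact h.qPoch_d_ne N)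
    (by rw [a3]; exact h.qPoch_a_inv_ne le_rfl) (by rw [a4]; exact hp4)
    (by rw [a5]; exact h.qPoch_pow_ne (m := 2) (by norm_num) (by norm_num) le_rfl)
  -- With a = q^n, the two a-dependent products in Watson's prefactor are reversals of (q^2;q^4)_N
  -- and (q;q^4)_N. Their monomial factors differ by q^(-N), the power in the theorem.
  have hr1 := qPoch_reverse (x := q ^ 3 / a) (y := q ^ 2) (k := N) hQ0 (pow_ne_zero _ hq0)
    (by rw [ha, ← pow_mul, pow_succ]; field_simp; ring)
  have hr2 := qPoch_reverse (x := q ^ 4 / a) (y := q) (k := N) hQ0 hq0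
    (by rw [ha, ← pow_mul, pow_succ]; field_simp; ring)
  have hrr : ∏ i ∈ Finset.range N, (-(1 / (q ^ 2 * (q ^ 4) ^ i)))
      = (q ^ N)⁻¹ * ∏ i ∈ Finset.range N, (-(1 / (q * (q ^ 4) ^ i))) := by
    rw [← inv_pow, ← Finset.card_range N, ← Finset.prod_const, Finset.card_range,
      ← Finset.prod_mul_distrib]
    refine Finset.prod_congr rfl fun i _ => ?_
    field_simp
  have hP : ∏ i ∈ Finset.range N, (-(1 / (q * (q ^ 4) ^ i))) ≠ 0 :=
    Finset.prod_ne_zero_iff.2 fun i _ => neg_ne_zero.2 (one_div_ne_zero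
      (mul_ne_zero hq0 (pow_ne_zero _ hQ0)))
  rw [a1, a2, a3, a4, a5, a6, a7, a8, a9, a10, qInt_mul_eq h1q, hr1, hr2, hrr] at w
  refine mul_left_cancel₀ h1q (Eq.trans ?_ (w.trans ?_))
  · rw [lhsSum_eq_deformedSum, deformedSum, Finset.mul_sum]
    refine Finset.sum_congr rfl fun k hk => ?_
    have hk' := Nat.lt_succ_iff.1 (Finset.mem_range.1 hk)
    have e : (1 - q) * qInt q (8 * k + 1) = 1 - q * (q ^ 4) ^ (2 * k) := by
      rw [qInt, mul_div_cancel₀ _ h1q]; ring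
    rw [← mul_assoc, ← mul_assoc, ← mul_assoc, e, mul_pow, ← pow_mul, div_one, mul_one]
    ring
  · rw [rhsSum_eq_deformedRhsSum, deformedRhsSum, ← mul_assoc (1 - q)]
    congr 1
    · field_simp
    · refine Finset.sum_congr rfl fun k _ => ?_
      rw [← pow_mul, mul_comm q a, div_one, div_one]
      ring

end Evaluations

/-! ### Product formulas at a primitive root of unity and the factor containing h_q(a). -/

section RootsOfUnity

variable {F : Type*} [Field F]

theorem qPoch_prod_four (q : F) (N : ℕ) :
    qPoch q (q ^ 4) N * qPoch (q ^ 2) (q ^ 4) N * qPoch (q ^ 3) (q ^ 4) N * qPoch (q ^ 4) (q ^ 4) N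
      = ∏ k ∈ Finset.range (4 * N), (1 - q ^ (k + 1)) := by
  induction N with
  | zero => simp [qPoch_zero]
  | succ N ih =>
    rw [show 4 * (N + 1) = 4 * N + 1 + 1 + 1 + 1 by ring, Finset.prod_range_succ,
      Finset.prod_range_succ, Finset.prod_range_succ, Finset.prod_range_succ, ← ih,
      qPoch_succ, qPoch_succ, qPoch_succ, qPoch_succ]
    ring

theorem prod_one_sub_mul_pow {q : F} {n : ℕ} (hn : 0 < n) (hq : IsPrimitiveRoot q n) (x : F) :
    ∏ i ∈ Finset.range n, (1 - x * q ^ i) = 1 - x ^ n := by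
  rw [← one_pow n, hq.pow_sub_pow_eq_prod_sub_mul 1 x hn, one_pow]
  refine Finset.prod_nbij (fun i => q ^ i) (fun i hi => ?_) (fun i hi j hj hij => ?_)
    (fun y hy => ?_) fun i _ => by rw [mul_comm]
  · rw [Polynomial.mem_nthRootsFinset hn, ← pow_mul, mul_comm, pow_mul, hq.pow_eq_one, one_pow]
  · exact hq.pow_inj (Finset.mem_range.1 hi) (Finset.mem_range.1 hj) hij
  · have : NeZero n := ⟨hn.ne'⟩
    obtain ⟨i, hi, rfl⟩ := hq.eq_pow_of_pow_eq_one ((Polynomial.mem_nthRootsFinset hn _).1 hy)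
    exact ⟨i, Finset.mem_coe.2 (Finset.mem_range.2 hi), rfl⟩

theorem qPoch_even_pair (x q : F) (N : ℕ) :
    qPoch (x * q ^ 2) (q ^ 4) N * qPoch (x * q ^ 4) (q ^ 4) N
      = ∏ l ∈ Finset.range (2 * N), (1 - x * q ^ (2 * l + 2)) := by
  induction N with
  | zero => simp [qPoch_zero]
  | succ N ih =>
    rw [show 2 * (N + 1) = 2 * N + 1 + 1 by ring, Finset.prod_range_succ,
      Finset.prod_range_succ, ← ih, qPoch_succ, qPoch_succ]
    ring

/-- Factor 1 - a^n into the 1 - a q^i. Even i give the products in a; since n is odd, odd i are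
negatives of even exponents mod n, giving the products in 1/a up to a monomial. -/
theorem one_sub_pow_eq_qPoch {q a : F} {N : ℕ} (hq : IsPrimitiveRoot q (4 * N + 1))
    (ha : a ≠ 0) :
    q ^ N * (1 - a ^ (4 * N + 1)) = (1 - a) * a ^ (2 * N)
      * (qPoch (a * q ^ 2) (q ^ 4) N * qPoch (a * q ^ 4) (q ^ 4) N)
      * (qPoch (q ^ 2 / a) (q ^ 4) N * qPoch (q ^ 4 / a) (q ^ 4) N) := by
  have hn := hq.pow_eq_one
  rw [div_eq_inv_mul, div_eq_inv_mul, qPoch_even_pair, qPoch_even_pair,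
    ← prod_one_sub_mul_pow (Nat.succ_pos _) hq, Finset.prod_range_succ']
  have split : ∀ N : ℕ, ∏ k ∈ Finset.range (4 * N), (1 - a * q ^ (k + 1))
      = (∏ l ∈ Finset.range (2 * N), (1 - a * q ^ (2 * l + 2)))
        * ∏ l ∈ Finset.range (2 * N), (1 - a * q ^ (2 * l + 1)) := by
    intro N
    rw [← Finset.prod_mul_distrib]
    induction N with
    | zero => simp
    | succ N ih =>
      rw [show 4 * (N + 1) = 4 * N + 1 + 1 + 1 + 1 by ring,
        show 2 * (N + 1) = 2 * N + 1 + 1 by ring, Finset.prod_range_succ,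
        Finset.prod_range_succ, Finset.prod_range_succ, Finset.prod_range_succ,
        Finset.prod_range_succ, Finset.prod_range_succ, ih]
      ring
  have inv : a ^ (2 * N) * ∏ l ∈ Finset.range (2 * N), (1 - a⁻¹ * q ^ (2 * l + 2))
      = q ^ N * ∏ l ∈ Finset.range (2 * N), (1 - a * q ^ (2 * l + 1)) := by
    have h1 : a ^ (2 * N) * ∏ l ∈ Finset.range (2 * N), (1 - a⁻¹ * q ^ (2 * l + 2))
        = ∏ l ∈ Finset.range (2 * N), (a - q ^ (2 * l + 2)) := by
      conv_lhs => rw [← Finset.card_range (2 * N), ← Finset.prod_const, Finset.card_range,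
        ← Finset.prod_mul_distrib]
      exact Finset.prod_congr rfl fun l _ => by field_simp
    have h2 : ∀ l ∈ Finset.range (2 * N), a - q ^ (2 * l + 2)
        = (-(q ^ (2 * l + 2))) * (1 - a * q ^ (2 * (2 * N - 1 - l) + 1)) := by
      intro l hl
      have hl' := Finset.mem_range.1 hl
      have : q ^ (2 * l + 2) * q ^ (2 * (2 * N - 1 - l) + 1) = 1 := by
        rw [← pow_add, ← hn]; congr 1; omega
      linear_combination -a * this
    -- The 2N signs cancel and the exponents add up to 2N(2N+1) = Nn + N.
    have h3 : ∏ l ∈ Finset.range (2 * N), (-(q ^ (2 * l + 2))) = q ^ N := by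
      have : ∀ N : ℕ, ∏ l ∈ Finset.range (2 * N), (-(q ^ (2 * l + 2)))
          = q ^ (N * (4 * N + 1) + N) := by
        intro N
        induction N with
        | zero => simp
        | succ N ih =>
          rw [show 2 * (N + 1) = 2 * N + 1 + 1 by ring, Finset.prod_range_succ,
            Finset.prod_range_succ, ih]
          ring
      rw [this, pow_add, mul_comm N, pow_mul, hn, one_pow, one_mul]
    rw [h1, Finset.prod_congr rfl h2, Finset.prod_mul_distrib, h3,
      Finset.prod_range_reflect (fun l => 1 - a * q ^ (2 * l + 1)) (2 * N)]
  rw [split, pow_zero, mul_one]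
  linear_combination -(1 - a) * (∏ l ∈ Finset.range (2 * N), (1 - a * q ^ (2 * l + 2))) * inv

/-- The right-hand factor without `[n]`. -/
def reducedFactor (N : ℕ) (q a : F) : F :=
  (q ^ N)⁻¹ * (qPoch (q ^ 2) (q ^ 4) N / qPoch (q ^ 4) (q ^ 4) N
    + hNum (4 * N + 1) q a / ((1 - a) ^ 2 * (1 - a ^ (4 * N + 1))
        * (qPoch (q ^ 2) (q ^ 4) N * qPoch (q ^ 4) (q ^ 4) N)))

theorem rhsFactor_eq (N : ℕ) (q a : F) :
    rhsFactor (4 * N + 1) q a = qInt q (4 * N + 1) * reducedFactor N q a := by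
  unfold rhsFactor reducedFactor
  rw [show (4 * N + 1 - 1) / 4 = N by omega,
    show (1 - ((4 * N + 1 : ℕ) : ℤ)) / 4 = -(N : ℤ) by omega, zpow_neg, zpow_natCast]
  ring

theorem rhsFactor_eq_of_hNum_eq_zero {N : ℕ} {q a : F} (h : hNum (4 * N + 1) q a = 0) :
    rhsFactor (4 * N + 1) q a
      = (q ^ N)⁻¹ * qInt q (4 * N + 1) * (qPoch (q ^ 2) (q ^ 4) N / qPoch (q ^ 4) (q ^ 4) N) := by
  rw [rhsFactor_eq, reducedFactor, h]
  ring

/-- The integer n in h_q(a) is the product of all 1 - q^k with 0 < k < n, hence of the four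
residue-class products; together with the factorization of 1 - a^n this removes n and a^n. -/
theorem reducedFactor_eq_deformedFactor {N : ℕ} {q a c d : F} (h : Nondegenerate N q a c d)
    (hq : IsPrimitiveRoot q (4 * N + 1)) : reducedFactor N q a = deformedFactor N q a := by
  have hn := hq.pow_eq_one
  have hp2 := h.qPoch_pow_ne (m := 2) (k := N) (by norm_num) (by norm_num) le_rfl
  have hp4 := h.qPoch_pow_ne (m := 4) (k := N) (by norm_num) (by norm_num) le_rfl
  have n5 := h.qPoch_a_ne (k := N) le_rfl
  have n6 := h.qPoch_a_inv_ne (k := N) le_rfl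
  have e1 := qPoch_prod_four q N
  rw [hq.prod_one_sub_pow_eq_order] at e1
  have e2 := one_sub_pow_eq_qPoch hq h.a_ne
  have ha1 := h.a_one
  have han : 1 - a ^ (4 * N + 1) ≠ 0 := fun h0 => h.a_pow (sub_eq_zero.1 h0).symm
  have hqN : q ^ N ≠ 0 := pow_ne_zero _ h.q_ne
  unfold reducedFactor deformedFactor hNum
  rw [show (4 * N + 1 - 1) / 4 = N by omega, show (4 * N + 1 - 1) / 2 = 2 * N by omega, hn]
  rw [mul_comm (q ^ 4) a] at *
  push_cast at e1 ⊢
  generalize a ^ (4 * N + 1) = an at *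
  generalize a ^ (2 * N) = am at *
  generalize qPoch (q ^ 2 / a) (q ^ 4) N = u1 at *
  generalize qPoch (q ^ 4 / a) (q ^ 4) N = u2 at *
  generalize qPoch (a * q ^ 2) (q ^ 4) N = u3 at *
  generalize qPoch (a * q ^ 4) (q ^ 4) N = u4 at *
  generalize qPoch q (q ^ 4) N = p1 at *
  generalize qPoch (q ^ 2) (q ^ 4) N = p2 at *
  generalize qPoch (q ^ 3) (q ^ 4) N = p3 at *
  generalize qPoch (q ^ 4) (q ^ 4) N = p4 at *
  generalize q ^ N = qN at *
  generalize (4 * (N : F) + 1) = m at *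
  -- Once q^n = 1, the outer factor of h_q(a) is -(1-a)^2, so its first half cancels p2/p4 and only
  -- the term with n survives.
  have step : p2 / p4 + (1 - a * 1) * (a - 1) * (p2 ^ 2 * (1 - an) - m * (u3 * u1) * (1 - a) * am)
        / ((1 - a) ^ 2 * (1 - an) * (p2 * p4))
      = m * (u3 * u1) * (1 - a) * am / ((1 - an) * (p2 * p4)) := by
    field_simp
    ring
  rw [step, ← e1]
  rw [inv_mul_eq_div, div_div, div_eq_div_iff (mul_ne_zero (mul_ne_zero han (mul_ne_zero hp2 hp4)) hqN)
    (mul_ne_zero n6 n5)]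
  linear_combination -(p1 * p2 * p3 * p4) * e2

end RootsOfUnity

/-! ### Invariance of both sums under a ↦ 1/a. -/

section Symmetry

variable {F : Type*} [Field F]

theorem lhsSum_inv (n : ℕ) (q a c d : F) : lhsSum n q a⁻¹ c d = lhsSum n q a c d := by
  unfold lhsSum
  refine Finset.sum_congr rfl fun k _ => ?_
  simp only [div_inv_eq_mul, ← div_eq_mul_inv]
  ring

theorem rhsSum_inv (n : ℕ) (q a c d : F) : rhsSum n q a⁻¹ c d = rhsSum n q a c d := by
  unfold rhsSum
  refine Finset.sum_congr rfl fun k _ => ?_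
  rw [div_inv_eq_mul, mul_comm a⁻¹, ← div_eq_mul_inv, mul_comm q a]
  ring

end Symmetry

/-! ### Reduction from a local ring to its residue field. -/

section Specialization

variable {O F K : Type*} [CommRing O] [Field F] [Field K]

/-- `x : F` lies in the image of `i`, with image `y : K` under `π`. -/
def ReducesTo (i : O →+* F) (π : O →+* K) (x : F) (y : K) : Prop :=
  ∃ o, i o = x ∧ π o = y

namespace ReducesTo

variable {i : O →+* F} {π : O →+* K} {x x' : F} {y y' : K}

theorem one : ReducesTo i π 1 1 := ⟨1, map_one i, map_one π⟩

theorem natCast (n : ℕ) : ReducesTo i π n n := ⟨n, map_natCast i n, map_natCast π n⟩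

theorem add (h : ReducesTo i π x y) (h' : ReducesTo i π x' y') :
    ReducesTo i π (x + x') (y + y') := by
  obtain ⟨o, rfl, rfl⟩ := h; obtain ⟨o', rfl, rfl⟩ := h'
  exact ⟨o + o', map_add .., map_add ..⟩

theorem sub (h : ReducesTo i π x y) (h' : ReducesTo i π x' y') :
    ReducesTo i π (x - x') (y - y') := by
  obtain ⟨o, rfl, rfl⟩ := h; obtain ⟨o', rfl, rfl⟩ := h'
  exact ⟨o - o', map_sub .., map_sub ..⟩

theorem mul (h : ReducesTo i π x y) (h' : ReducesTo i π x' y') :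
    ReducesTo i π (x * x') (y * y') := by
  obtain ⟨o, rfl, rfl⟩ := h; obtain ⟨o', rfl, rfl⟩ := h'
  exact ⟨o * o', map_mul .., map_mul ..⟩

theorem pow (h : ReducesTo i π x y) (n : ℕ) : ReducesTo i π (x ^ n) (y ^ n) := by
  obtain ⟨o, rfl, rfl⟩ := h
  exact ⟨o ^ n, map_pow .., map_pow ..⟩

theorem sum {s : Finset ℕ} {f : ℕ → F} {g : ℕ → K} (h : ∀ k ∈ s, ReducesTo i π (f k) (g k)) :
    ReducesTo i π (∑ k ∈ s, f k) (∑ k ∈ s, g k) := by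
  choose! o h1 h2 using h
  exact ⟨∑ k ∈ s, o k, by rw [map_sum]; exact Finset.sum_congr rfl h1,
    by rw [map_sum]; exact Finset.sum_congr rfl h2⟩

theorem prod {s : Finset ℕ} {f : ℕ → F} {g : ℕ → K} (h : ∀ k ∈ s, ReducesTo i π (f k) (g k)) :
    ReducesTo i π (∏ k ∈ s, f k) (∏ k ∈ s, g k) := by
  choose! o h1 h2 using h
  exact ⟨∏ k ∈ s, o k, by rw [map_prod]; exact Finset.prod_congr rfl h1,
    by rw [map_prod]; exact Finset.prod_congr rfl h2⟩

theorem qPoch (h : ReducesTo i π x y) (h' : ReducesTo i π x' y') (k : ℕ) :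
    ReducesTo i π (qPoch x x' k) (qPoch y y' k) :=
  prod fun j _ => one.sub (h.mul (h'.pow j))

variable [IsLocalHom π]

/-- A nonzero residue lifts to a unit because π is local; hence a fraction reduces as soon as its
denominators survive in K, which is what `Nondegenerate` guarantees. -/
theorem inv (h : ReducesTo i π x y) (hy : y ≠ 0) : ReducesTo i π x⁻¹ y⁻¹ := by
  obtain ⟨o, rfl, rfl⟩ := h
  obtain ⟨u, rfl⟩ := isUnit_of_map_unit π o hy.isUnit
  exact ⟨↑u⁻¹, map_units_inv i u, map_units_inv π u⟩

theorem div (h : ReducesTo i π x y) (h' : ReducesTo i π x' y') (hy : y' ≠ 0) :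
    ReducesTo i π (x / x') (y / y') := by
  rw [div_eq_mul_inv, div_eq_mul_inv]
  exact h.mul (h'.inv hy)

variable {N : ℕ} {q a c d : F} {q' a' c' d' : K}

theorem qInt (hq : ReducesTo i π q q') (h : 1 - q' ≠ 0) (m : ℕ) :
    ReducesTo i π (qInt q m) (qInt q' m) :=
  (one.sub (hq.pow m)).div (one.sub hq) h

variable (hq : ReducesTo i π q q') (ha : ReducesTo i π a a') (hc : ReducesTo i π c c')
  (hd : ReducesTo i π d d') (h : Nondegenerate N q' a' c' d')
include hq ha hc hd h

theorem lhsSum : ReducesTo i π (lhsSum (4 * N + 1) q a c d) (lhsSum (4 * N + 1) q' a' c' d') := by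
  unfold _root_.lhsSum
  rw [show (4 * N + 1 - 1) / 4 = N by omega]
  refine sum fun k hk => ?_
  have hk' := Nat.lt_succ_iff.1 (Finset.mem_range.1 hk)
  have h4 := h.qPoch_pow_ne (m := 4) (by norm_num) le_rfl hk'
  have hQ := hq.pow 4
  simp only [zpow_neg, zpow_natCast]
  refine (((hq.qInt h.one_sub_q _).mul (div (((((((hq.qPoch hQ k).pow 2).mul
    ((hc.mul hq).qPoch hQ k)).mul ((hd.mul hq).qPoch hQ k)).mul ((hq.mul ha).qPoch hQ k)).mul
    ((hq.div ha h.a_ne).qPoch hQ k))) (((((((hQ.qPoch hQ k).pow 2).mul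
    ((hQ.div hc h.c_ne).qPoch hQ k)).mul ((hQ.div hd h.d_ne).qPoch hQ k)).mul
    ((hQ.mul ha).qPoch hQ k)).mul ((hQ.div ha h.a_ne).qPoch hQ k))) ?_)).mul
    (((hc.mul hd).pow k).inv (pow_ne_zero _ (mul_ne_zero h.c_ne h.d_ne)))).mul (hq.pow _)
  exact mul_ne_zero (mul_ne_zero (mul_ne_zero (mul_ne_zero (pow_ne_zero _ h4) (h.qPoch_c_ne k))
    (h.qPoch_d_ne k)) (h.qPoch_a_ne hk')) (h.qPoch_a_inv_ne hk')

theorem deformedRhsSum {b : F} {b' : K} (hb : ReducesTo i π b b') (hb0 : b' ≠ 0)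
    (hb2 : _root_.qPoch (q' ^ 2 / b') (q' ^ 4) N ≠ 0) :
    ReducesTo i π (deformedRhsSum N q a b c d) (deformedRhsSum N q' a' b' c' d') := by
  refine sum fun k hk => ?_
  have hk' := Nat.lt_succ_iff.1 (Finset.mem_range.1 hk)
  have h4 := h.qPoch_pow_ne (m := 4) (by norm_num) le_rfl hk'
  have hQ := hq.pow 4
  refine (div ((((((hq.div hb hb0).qPoch hQ k)).mul
    (((hq.pow 3).div (hc.mul hd) (mul_ne_zero h.c_ne h.d_ne)).qPoch hQ k)).mul
    ((ha.mul hq).qPoch hQ k)).mul ((hq.div ha h.a_ne).qPoch hQ k))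
    (((((((hq.pow 2).div hb hb0).qPoch hQ k).mul (hQ.qPoch hQ k)).mul
    ((hQ.div hc h.c_ne).qPoch hQ k))).mul ((hQ.div hd h.d_ne).qPoch hQ k)) ?_).mul (hq.pow _)
  exact mul_ne_zero (mul_ne_zero (mul_ne_zero (qPoch_ne_zero_of_le hb2 hk') h4) (h.qPoch_c_ne k))
    (h.qPoch_d_ne k)

theorem rhsSum : ReducesTo i π (rhsSum (4 * N + 1) q a c d) (rhsSum (4 * N + 1) q' a' c' d') := by
  rw [rhsSum_eq_deformedRhsSum, rhsSum_eq_deformedRhsSum]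
  refine deformedRhsSum hq ha hc hd h one one_ne_zero ?_
  rw [div_one]
  exact h.qPoch_pow_ne (by norm_num) (by norm_num) le_rfl

omit hc hd in
theorem deformedFactor : ReducesTo i π (deformedFactor N q a) (deformedFactor N q' a') := by
  have hQ := hq.pow 4
  exact ((hq.qPoch hQ N).mul ((hq.pow 3).qPoch hQ N)).div
    (((hQ.div ha h.a_ne).qPoch hQ N).mul ((hQ.mul ha).qPoch hQ N))
    (mul_ne_zero (h.qPoch_a_inv_ne le_rfl) (h.qPoch_a_ne le_rfl))

omit hc hd in
theorem reducedFactor : ReducesTo i π (reducedFactor N q a) (reducedFactor N q' a') := by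
  have hQ := hq.pow 4
  have h2 := h.qPoch_pow_ne (m := 2) (k := N) (by norm_num) (by norm_num) le_rfl
  have h4 := h.qPoch_pow_ne (m := 4) (k := N) (by norm_num) le_rfl le_rfl
  have han : 1 - a' ^ (4 * N + 1) ≠ 0 := fun h0 => h.a_pow (sub_eq_zero.1 h0).symm
  have p2 := (hq.pow 2).qPoch hQ N
  have p4 := hQ.qPoch hQ N
  unfold _root_.reducedFactor hNum
  rw [show (4 * N + 1 - 1) / 4 = N by omega]
  exact ((hq.pow N).inv (pow_ne_zero _ h.q_ne)).mul ((p2.div p4 h4).add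
    ((((one.sub (ha.mul (hq.pow _))).mul (ha.sub (hq.pow _))).mul
      (((p2.pow 2).mul (one.sub (ha.pow _))).sub ((((natCast _).mul
        (((ha.mul (hq.pow 2)).qPoch hQ N).mul (((hq.pow 2).div ha h.a_ne).qPoch hQ N))).mul
        (one.sub ha)).mul (ha.pow _)))).div
      ((((one.sub ha).pow 2).mul (one.sub (ha.pow _))).mul (p2.mul p4))
      (mul_ne_zero (mul_ne_zero (pow_ne_zero _ h.a_one) han) (mul_ne_zero h2 h4))))

theorem rhs : ReducesTo i π (rhsFactor (4 * N + 1) q a * _root_.rhsSum (4 * N + 1) q a c d)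
    (rhsFactor (4 * N + 1) q' a' * _root_.rhsSum (4 * N + 1) q' a' c' d') := by
  rw [rhsFactor_eq, rhsFactor_eq]
  exact ((hq.qInt h.one_sub_q _).mul (reducedFactor hq ha h)).mul (rhsSum hq ha hc hd h)

end ReducesTo

end Specialization

/-! ### The deformed sum as a polynomial in b over a common denominator. -/

open Polynomial in
/-- The common denominator `(q⁴X; q⁴)_N` of the deformed sum, as a polynomial in `X`. -/
noncomputable def deformedDenom {R : Type*} [CommRing R] (q : R) (N : ℕ) : R[X] :=
  ∏ l ∈ Finset.range N, (1 - C (q ^ 4 * (q ^ 4) ^ l) * X)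

open Polynomial in
/-- The numerator of the deformed sum over `deformedDenom`, with given coefficients `t`. -/
noncomputable def deformedNum {R : Type*} [CommRing R] (q : R) (t : ℕ → R) (N : ℕ) : R[X] :=
  ∑ k ∈ Finset.range (N + 1), C (t k) * ((∏ l ∈ Finset.range k, (X - C (q * (q ^ 4) ^ l)))
    * ∏ l ∈ Finset.range (N - k), (1 - C (q ^ 4 * (q ^ 4) ^ (k + l)) * X))

/-- The part of the `k`-th term of the deformed sum that does not involve `b`. -/
def deformedCoeff {F : Type*} [Field F] (q a c d : F) (k : ℕ) : F :=
  qInt q (8 * k + 1)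
    * ((qPoch q (q ^ 4) k * qPoch (c * q) (q ^ 4) k
          * qPoch (d * q) (q ^ 4) k * qPoch (q * a) (q ^ 4) k * qPoch (q / a) (q ^ 4) k)
        / (qPoch (q ^ 4) (q ^ 4) k * qPoch (q ^ 4 / c) (q ^ 4) k * qPoch (q ^ 4 / d) (q ^ 4) k
          * qPoch (q ^ 4 * a) (q ^ 4) k * qPoch (q ^ 4 / a) (q ^ 4) k))
    * (1 / (c * d)) ^ k * q ^ (5 * k)

section Deformation

variable {R S : Type*} [CommRing R] [CommRing S]

theorem map_deformedNum (f : R →+* S) (q : R) (t : ℕ → R) (N : ℕ) :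
    (deformedNum q t N).map f = deformedNum (f q) (fun k => f (t k)) N := by
  simp [deformedNum, Polynomial.map_sum, Polynomial.map_prod]

theorem map_deformedDenom (f : R →+* S) (q : R) (N : ℕ) :
    (deformedDenom q N).map f = deformedDenom (f q) N := by
  simp [deformedDenom, Polynomial.map_prod]

theorem deformedNum_congr (q : R) {t t' : ℕ → R} {N : ℕ} (h : ∀ k ≤ N, t k = t' k) :
    deformedNum q t N = deformedNum q t' N :=
  Finset.sum_congr rfl fun k hk => by rw [h k (Nat.lt_succ_iff.1 (Finset.mem_range.1 hk))]

variable {F : Type*} [Field F]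

theorem eval_deformedDenom (q b : F) (N : ℕ) :
    (deformedDenom q N).eval b = qPoch (q ^ 4 * b) (q ^ 4) N := by
  simp only [deformedDenom, Polynomial.eval_prod, qPoch, Polynomial.eval_sub, Polynomial.eval_one,
    Polynomial.eval_mul, Polynomial.eval_C, Polynomial.eval_X]
  exact Finset.prod_congr rfl fun l _ => by ring

/-- The weight b^k absorbs the poles of (q/b;q^4)_k at b = 0, so clearing (q^4 b;q^4)_N leaves a
genuine polynomial in b. -/
theorem eval_deformedNum {q b : F} (a c d : F) {N : ℕ} (hb : b ≠ 0)
    (hb' : qPoch (q ^ 4 * b) (q ^ 4) N ≠ 0) :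
    (deformedNum q (deformedCoeff q a c d) N).eval b
      = qPoch (q ^ 4 * b) (q ^ 4) N * deformedSum N q a b c d := by
  rw [deformedNum, Polynomial.eval_finsetSum, deformedSum, Finset.mul_sum]
  refine Finset.sum_congr rfl fun k hk => ?_
  obtain ⟨m, rfl⟩ := Nat.exists_eq_add_of_le (Nat.lt_succ_iff.1 (Finset.mem_range.1 hk))
  simp only [Polynomial.eval_prod, Polynomial.eval_sub, Polynomial.eval_one,
    Polynomial.eval_mul, Polynomial.eval_C, Polynomial.eval_X, Nat.add_sub_cancel_left]
  have e1 : ∏ l ∈ Finset.range k, (b - q * (q ^ 4) ^ l) = qPoch (q / b) (q ^ 4) k * b ^ k := by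
    conv_rhs => rw [← Finset.card_range k, ← Finset.prod_const, Finset.card_range, qPoch,
      ← Finset.prod_mul_distrib]
    exact Finset.prod_congr rfl fun l _ => by field_simp
  have e2 : ∏ l ∈ Finset.range m, (1 - q ^ 4 * (q ^ 4) ^ (k + l) * b)
      = qPoch (q ^ 4 * b * (q ^ 4) ^ k) (q ^ 4) m :=
    Finset.prod_congr rfl fun l _ => by rw [pow_add]; ring
  rw [e1, e2, qPoch_add (q ^ 4 * b), deformedCoeff]
  have hk0 : qPoch (q ^ 4 * b) (q ^ 4) k ≠ 0 :=
    qPoch_ne_zero_of_le hb' (Nat.le_add_right k m)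
  have e3 : (b / (c * d)) ^ k = b ^ k * (1 / (c * d)) ^ k := by
    rw [← mul_pow, mul_one_div]
  rw [e3]
  generalize qPoch (q ^ 4 * b * (q ^ 4) ^ k) (q ^ 4) m = v
  generalize (1 / (c * d)) ^ k = w
  generalize qPoch (q ^ 4 * b) (q ^ 4) k = r at *
  generalize qPoch (q / b) (q ^ 4) k = u1
  generalize qPoch q (q ^ 4) k = u2
  generalize qPoch (c * q) (q ^ 4) k = u3
  generalize qPoch (d * q) (q ^ 4) k = u4
  generalize qPoch (q * a) (q ^ 4) k = u5
  generalize qPoch (q / a) (q ^ 4) k = u6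
  generalize qPoch (q ^ 4) (q ^ 4) k = v1
  generalize qPoch (q ^ 4 / c) (q ^ 4) k = v2
  generalize qPoch (q ^ 4 / d) (q ^ 4) k = v3
  generalize qPoch (q ^ 4 * a) (q ^ 4) k = v4
  generalize qPoch (q ^ 4 / a) (q ^ 4) k = v5
  rw [show r * v * (qInt q (8 * k + 1) * (u2 * u1 * u3 * u4 * u5 * u6 / (v1 * r * v2 * v3 * v4 * v5))
      * (b ^ k * w) * q ^ (5 * k))
    = qInt q (8 * k + 1) * (u2 * u3 * u4 * u5 * u6 / (v1 * v2 * v3 * v4 * v5)) * w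
        * q ^ (5 * k) * (u1 * b ^ k * v) * (r * r⁻¹) by ring, mul_inv_cancel₀ hk0, mul_one]

theorem deformedNum_eq_zero [CharZero F] {N : ℕ} {q a c d : F} (h : Nondegenerate N q a c d)
    (hq : q ^ (4 * N + 1) = 1) : deformedNum q (deformedCoeff q a c d) N = 0 := by
  have : Infinite F := Infinite.of_injective (Nat.cast : ℕ → F) Nat.cast_injective
  -- The extra factors vanish exactly where the deformed sum is not controlled (b = 0 and the
  -- poles), so the product is zero at every point of an infinite field.
  have key : Polynomial.X * deformedDenom q N * deformedNum q (deformedCoeff q a c d) N = 0 := by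
    refine Polynomial.funext fun b => ?_
    rw [Polynomial.eval_mul, Polynomial.eval_mul, Polynomial.eval_X, eval_deformedDenom,
      Polynomial.eval_zero]
    by_cases hb : b = 0
    · rw [hb, zero_mul, zero_mul]
    by_cases hb' : qPoch (q ^ 4 * b) (q ^ 4) N = 0
    · rw [hb', mul_zero, zero_mul]
    rw [eval_deformedNum a c d hb hb',
      deformedSum_eq_zero_of_root_of_unity h two_ne_zero hb hb' hq, mul_zero, mul_zero]
  refine (mul_eq_zero.1 key).resolve_left (mul_ne_zero Polynomial.X_ne_zero fun h0 => ?_)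
  have := eval_deformedDenom q 0 N
  rw [h0, Polynomial.eval_zero, mul_zero] at this
  simp [qPoch] at this

end Deformation

/-! ### The congruence modulo p². -/

section SquareCongruence

variable {O F K : Type*} [CommRing O] [Field F] [Field K] {i : O →+* F} {π : O →+* K}
  [IsLocalHom π] {N : ℕ} {q a c d : F} {q' a' c' d' : K}

theorem ReducesTo.deformedCoeff (hq : ReducesTo i π q q') (ha : ReducesTo i π a a')
    (hc : ReducesTo i π c c') (hd : ReducesTo i π d d') (h : Nondegenerate N q' a' c' d')
    {k : ℕ} (hk : k ≤ N) :
    ReducesTo i π (deformedCoeff q a c d k) (deformedCoeff q' a' c' d' k) := by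
  have h4 := h.qPoch_pow_ne (m := 4) (by norm_num) le_rfl hk
  have hQ := hq.pow 4
  refine (((hq.qInt h.one_sub_q _).mul (div ((((((hq.qPoch hQ k)).mul
    ((hc.mul hq).qPoch hQ k)).mul ((hd.mul hq).qPoch hQ k)).mul ((hq.mul ha).qPoch hQ k)).mul
    ((hq.div ha h.a_ne).qPoch hQ k)) ((((((hQ.qPoch hQ k)).mul
    ((hQ.div hc h.c_ne).qPoch hQ k)).mul ((hQ.div hd h.d_ne).qPoch hQ k)).mul
    ((hQ.mul ha).qPoch hQ k)).mul ((hQ.div ha h.a_ne).qPoch hQ k)) ?_)).mul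
    ((one.div (hc.mul hd) (mul_ne_zero h.c_ne h.d_ne)).pow k)).mul (hq.pow _)
  exact mul_ne_zero (mul_ne_zero (mul_ne_zero (mul_ne_zero h4 (h.qPoch_c_ne k))
    (h.qPoch_d_ne k)) (h.qPoch_a_ne hk)) (h.qPoch_a_inv_ne hk)

variable [CharZero K] {p : O} (hp : ∀ o, π o = 0 → p ∣ o)
  (hq : ReducesTo i π q q') (ha : ReducesTo i π a a')
  (hc : ReducesTo i π c c') (hd : ReducesTo i π d d') (h : Nondegenerate N q' a' c' d')
include hp hq ha hc hd h

/-- The numerator in b is p times a polynomial, and b = 1 and b = q^n have the same residue; one p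
comes from the coefficients, the other from the difference of values. -/
theorem deformedSum_sub_eq (hroot : q' ^ (4 * N + 1) = 1) :
    ∃ o, deformedSum N q a 1 c d - deformedSum N q a (q ^ (4 * N + 1)) c d = i (p ^ 2 * o) := by
  have ht := fun k (hk : k ≤ N) => hq.deformedCoeff ha hc hd h hk
  choose! τ hτ1 hτ2 using ht
  obtain ⟨r, rfl, rfl⟩ := hq
  set M := deformedNum r τ N with hM
  have hMi : M.map i = deformedNum (i r) (deformedCoeff (i r) a c d) N := by
    rw [hM, map_deformedNum]; exact deformedNum_congr _ hτ1
  have hMπ : M.map π = 0 := by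
    rw [hM, map_deformedNum, deformedNum_congr (π r) hτ2, deformedNum_eq_zero h hroot]
  obtain ⟨M₁, hM₁⟩ : Polynomial.C p ∣ M := by
    rw [Polynomial.C_dvd_iff_dvd_coeff]
    exact fun k => hp _ (by rw [← Polynomial.coeff_map, hMπ, Polynomial.coeff_zero])
  have den : ∀ s : O, π s = 1 → ∃ u : Oˣ, (u : O) = (deformedDenom r N).eval s := by
    intro s hs
    have : IsUnit ((deformedDenom r N).eval s) := by
      refine isUnit_of_map_unit π _ ?_
      rw [← Polynomial.eval_map_apply, map_deformedDenom, eval_deformedDenom, hs, mul_one]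
      exact (h.qPoch_pow_ne (m := 4) (by norm_num) le_rfl le_rfl).isUnit
    exact ⟨this.unit, this.unit_spec⟩
  have val : ∀ s : O, π s = 1 → ∀ u : Oˣ, (u : O) = (deformedDenom r N).eval s →
      deformedSum N (i r) a (i s) c d = i (p * M₁.eval s * ↑u⁻¹) := by
    intro s hs u hu
    have hsu : IsUnit s := isUnit_of_map_unit π s (by rw [hs]; exact isUnit_one)
    have hden : i (u : O) = qPoch (i r ^ 4 * i s) (i r ^ 4) N := by
      rw [hu, ← Polynomial.eval_map_apply, map_deformedDenom, eval_deformedDenom]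
    have hden0 : i (u : O) ≠ 0 := (u.isUnit.map i).ne_zero
    have hev := eval_deformedNum (q := i r) (b := i s) (N := N) a c d (hsu.map i).ne_zero
      (hden ▸ hden0)
    rw [← hMi, Polynomial.eval_map_apply, hM₁, Polynomial.eval_mul, Polynomial.eval_C,
      ← hden] at hev
    rw [map_mul, hev, map_units_inv]
    field_simp
  have hs2 : π (r ^ (4 * N + 1)) = 1 := by rw [map_pow, hroot]
  obtain ⟨u₁, hu₁⟩ := den 1 (map_one π)
  obtain ⟨u₂, hu₂⟩ := den _ hs2
  have v₁ := val 1 (map_one π) u₁ hu₁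
  have v₂ := val _ hs2 u₂ hu₂
  rw [map_one] at v₁
  rw [map_pow] at v₂
  have ev : ∀ P : Polynomial O, π (P.eval (r ^ (4 * N + 1))) = π (P.eval 1) := fun P => by
    rw [← Polynomial.eval_map_apply, ← Polynomial.eval_map_apply, hs2, map_one]
  -- Numerators and unit denominators have equal residues at the two points; this difference carries
  -- the second p.
  obtain ⟨w, hw⟩ := hp (M₁.eval 1 * ↑u₁⁻¹ - M₁.eval (r ^ (4 * N + 1)) * ↑u₂⁻¹) (by
    rw [map_sub, map_mul, map_mul, ev, map_units_inv, map_units_inv, hu₁, hu₂, ev, sub_self])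
  refine ⟨w, ?_⟩
  rw [v₁, v₂, ← map_sub]
  congr 1
  linear_combination p * hw

/-- The congruence modulo the square of a prime at which `q` is a primitive root of unity. -/
theorem lhsSum_sub_eq_sq (hF : Nondegenerate N q a c d) (hqF : ∀ m, 0 < m → q ^ m ≠ 1)
    (hroot : IsPrimitiveRoot q' (4 * N + 1)) :
    ∃ o, lhsSum (4 * N + 1) q a c d - rhsFactor (4 * N + 1) q a * rhsSum (4 * N + 1) q a c d
      = i (p ^ 2 * o) := by
  have hn := hroot.pow_eq_one
  obtain ⟨o₁, ho₁⟩ := deformedSum_sub_eq hp hq ha hc hd h hn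
  -- Watson is applied over F, where q is not a root of unity, before any reduction.
  rw [deformedSum_eq_of_eq_pow hF hqF, ← lhsSum_eq_deformedSum] at ho₁
  obtain ⟨o₂, ho₂, hz₂⟩ := hq.qInt h.one_sub_q (4 * N + 1)
  have hred : ReducesTo i π (deformedFactor N q a * deformedRhsSum N q a (q ^ (4 * N + 1)) c d
      - reducedFactor N q a * rhsSum (4 * N + 1) q a c d) 0 := by
    have := ((ReducesTo.deformedFactor hq ha h).mul (ReducesTo.deformedRhsSum hq ha hc hd h
      (hq.pow (4 * N + 1)) (by rw [hn]; exact one_ne_zero) (by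
        rw [hn, div_one]
        exact h.qPoch_pow_ne (by norm_num) (by norm_num) le_rfl))).sub
      ((ReducesTo.reducedFactor hq ha h).mul (ReducesTo.rhsSum hq ha hc hd h))
    rwa [hn, reducedFactor_eq_deformedFactor h hroot, ← rhsSum_eq_deformedRhsSum N q' a' c' d',
      sub_self] at this
  obtain ⟨o₃, ho₃, hz₃⟩ := hred
  rw [qInt, hn, sub_self, zero_div] at hz₂
  obtain ⟨w₂, rfl⟩ := hp _ hz₂
  obtain ⟨w₃, rfl⟩ := hp _ hz₃
  refine ⟨o₁ + w₂ * w₃, ?_⟩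
  rw [rhsFactor_eq, mul_add, map_add, ← ho₁, show p ^ 2 * (w₂ * w₃) = p * w₂ * (p * w₃) by ring,
    map_mul, ho₂, ho₃]
  ring

end SquareCongruence

/-! ### Localization of the polynomial ring at a principal prime. -/

section LocalRing

open MvPolynomial

variable (I : Ideal Poly4) [I.IsPrime]

/-- The inclusion of the localization at a prime into the field of rational functions. -/
noncomputable def localizationToRat : Localization.AtPrime I →+* Rat4 :=
  IsLocalization.lift (M := I.primeCompl) (g := algebraMap Poly4 Rat4) fun y =>
    IsUnit.mk0 _ fun h0 => y.2 (by
      rw [(IsFractionRing.injective Poly4 Rat4) (h0.trans (map_zero _).symm)]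
      exact I.zero_mem)

theorem localizationToRat_algebraMap (f : Poly4) :
    localizationToRat I (algebraMap Poly4 (Localization.AtPrime I) f) = algebraMap Poly4 Rat4 f :=
  IsLocalization.lift_eq _ f

theorem reducesTo_algebraMap (f : Poly4) :
    ReducesTo (localizationToRat I) (IsLocalRing.residue (Localization.AtPrime I))
      (algebraMap Poly4 Rat4 f) (algebraMap Poly4 I.ResidueField f) :=
  ⟨algebraMap _ _ f, localizationToRat_algebraMap I f, rfl⟩

variable {I}

theorem dvd_of_residue_eq_zero {p : Poly4} (hI : I = Ideal.span {p}) (o : Localization.AtPrime I)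
    (ho : IsLocalRing.residue (Localization.AtPrime I) o = 0) :
    algebraMap Poly4 (Localization.AtPrime I) p ∣ o := by
  rw [IsLocalRing.residue_eq_zero_iff, ← Localization.AtPrime.map_eq_maximalIdeal] at ho
  subst hI
  rwa [Ideal.map_span, Set.image_singleton, Ideal.mem_span_singleton] at ho

theorem algebraMap_residueField_eq_zero_iff {p : Poly4} (hI : I = Ideal.span {p}) (f : Poly4) :
    algebraMap Poly4 I.ResidueField f = 0 ↔ p ∣ f := by
  rw [Ideal.algebraMap_residueField_eq_zero, hI, Ideal.mem_span_singleton]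

/-- Clearing denominators gives U v = p^m u V with p not dividing v. The fraction U/V need not be
reduced. -/
theorem pow_dvd_num_of_eq {p : Poly4} (hp : Prime p) (hI : I = Ideal.span {p}) {m : ℕ} {A : Rat4}
    {o : Localization.AtPrime I}
    (hA : A = localizationToRat I (algebraMap Poly4 (Localization.AtPrime I) p ^ m * o))
    {U V : Poly4} (hV : V ≠ 0) (hUV : A = algebraMap Poly4 Rat4 U / algebraMap Poly4 Rat4 V) :
    p ^ m ∣ U := by
  have hinj := IsFractionRing.injective Poly4 Rat4
  have hmem : ∀ f : Poly4, f ∈ I ↔ p ∣ f := fun f => by rw [hI, Ideal.mem_span_singleton]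
  obtain ⟨⟨u, v⟩, huv⟩ := IsLocalization.surj I.primeCompl o
  have hv : ¬ p ∣ (v : Poly4) := fun h => by
    exact v.2 ((hmem v).2 h)
  have hV' : algebraMap Poly4 Rat4 V ≠ 0 := fun h0 => hV (hinj (h0.trans (map_zero _).symm))
  have key : A * algebraMap Poly4 Rat4 v = algebraMap Poly4 Rat4 (p ^ m * u) := by
    rw [hA, ← localizationToRat_algebraMap I v, ← map_mul, mul_assoc, huv, ← map_pow, ← map_mul,
      localizationToRat_algebraMap]
  rw [hUV, div_mul_eq_mul_div, div_eq_iff hV', ← map_mul, ← map_mul] at key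
  refine hp.pow_dvd_of_dvd_mul_left m hv ⟨u * V, ?_⟩
  rw [mul_comm, hinj key, mul_assoc]

end LocalRing

/-! ### Primality of the factors of the modulus. -/

section Primes

open MvPolynomial

theorem prime_X_one_sub (n : ℕ) : Prime (X 1 - X 0 ^ n : Poly4) := by
  have h := irreducible_mul_X_add (1 : Poly4) (-X 0 ^ n) 1 one_ne_zero (by simp)
    (by
      rw [vars_neg]
      intro h
      have := vars_pow _ _ h
      rw [vars_X, Finset.mem_singleton] at this
      exact absurd this (by decide)) isRelPrime_one_left
  rw [one_mul, ← sub_eq_add_neg] at h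
  exact h.prime

theorem prime_one_sub_X_mul (n : ℕ) : Prime (1 - X 1 * X 0 ^ n : Poly4) := by
  have h := irreducible_mul_X_add (-X 0 ^ n : Poly4) 1 1
    (neg_ne_zero.2 (pow_ne_zero _ (X_ne_zero _)))
    (by
      rw [vars_neg]
      intro h
      have := vars_pow _ _ h
      rw [vars_X, Finset.mem_singleton] at this
      exact absurd this (by decide)) (by simp) isRelPrime_one_right
  rw [show (-X 0 ^ n * X 1 + 1 : Poly4) = 1 - X 1 * X 0 ^ n by ring] at h
  exact h.prime

/-- A one-variable prime stays prime when further variables are adjoined: pass to polynomials in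
{s}, then rename into σ. -/
theorem prime_aeval_X {σ R : Type*} [CommRing R] (s : σ) {f : Polynomial R}
    (hf : Prime f) : Prime (Polynomial.aeval (X s : MvPolynomial σ R) f) := by
  have h1 : Prime ((uniqueAlgEquiv R ({s} : Set σ)).symm f) :=
    (MulEquiv.prime_iff (uniqueAlgEquiv R ({s} : Set σ)).symm).2 hf
  have h2 := (prime_rename_iff ({s} : Set σ)).2 h1
  convert h2 using 1
  have : Polynomial.aeval (X s : MvPolynomial σ R)
      = (rename ((↑) : ({s} : Set σ) → σ)).comp
        (uniqueAlgEquiv R ({s} : Set σ)).symm.toAlgHom := by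
    refine Polynomial.algHom_ext ?_
    have e : (uniqueAlgEquiv R ({s} : Set σ)).symm Polynomial.X = X default := by
      rw [AlgEquiv.symm_apply_eq]; simp [uniqueAlgEquiv]
    simp [e]
  rw [this]
  rfl

theorem prime_cyclotomic_X {n : ℕ} (hn : 0 < n) :
    Prime (Polynomial.aeval (X 0 : Poly4) (Polynomial.cyclotomic n ℤ)) :=
  prime_aeval_X 0 (Polynomial.cyclotomic.irreducible hn).prime

end Primes

/-! ### Nondegeneracy checked at numerical points. -/

section Nondegeneracy

open MvPolynomial

theorem Nondegenerate.inv {F : Type*} [Field F] {N : ℕ} {q a c d : F}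
    (h : Nondegenerate N q a c d) : Nondegenerate N q a⁻¹ c d where
  q_ne := h.q_ne
  a_ne := inv_ne_zero h.a_ne
  c_ne := h.c_ne
  d_ne := h.d_ne
  q_pow := h.q_pow
  q_one := h.q_one
  a_pow := by rw [inv_pow]; exact fun h0 => h.a_pow (inv_eq_one.1 h0)
  a_shift := fun j hj => by
    have ha := h.a_ne
    refine ⟨fun h0 => (h.a_shift j hj).2 ?_, fun h0 => (h.a_shift j hj).1 ?_⟩
    · rw [← h0, mul_inv_cancel₀ ha]
    · rw [inv_mul_eq_div, div_eq_one_iff_eq ha] at h0; exact h0.symm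
  c_shift := h.c_shift
  d_shift := h.d_shift

theorem eq_of_specialization {F G : Type*} [Field F] [Field G] {θ : Poly4 →+* F}
    {ψ : Poly4 →+* G} (hθ : ∀ f, θ f = 0 → ψ f = 0) {f g : Poly4} (h : θ f = θ g) : ψ f = ψ g := by
  rw [← sub_eq_zero, ← map_sub] at h ⊢
  exact hθ _ h

theorem pow_ne_one_of_specialization {F G : Type*} [Field F] [Field G] {θ : Poly4 →+* F}
    {ψ : Poly4 →+* G} (hθ : ∀ f, θ f = 0 → ψ f = 0) {f : Poly4} {m : ℕ} (h : ψ f ^ m ≠ 1) :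
    θ f ^ m ≠ 1 := fun h0 => h (by
  rw [← map_pow, ← map_one ψ]
  exact eq_of_specialization hθ (by rw [map_pow, h0, map_one]))

/-- Every condition says that some polynomial is nonzero, and the kernel of θ lies in that of ψ; so
one numerical point on p = 0 settles the residue field of (p). -/
theorem Nondegenerate.of_specialization {F G : Type*} [Field F] [Field G] {θ : Poly4 →+* F}
    {ψ : Poly4 →+* G} (hθ : ∀ f, θ f = 0 → ψ f = 0) {N : ℕ}
    (h : Nondegenerate N (ψ (X 0)) (ψ (X 1)) (ψ (X 2)) (ψ (X 3))) :
    Nondegenerate N (θ (X 0)) (θ (X 1)) (θ (X 2)) (θ (X 3)) where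
  q_ne := fun h0 => h.q_ne (hθ _ h0)
  a_ne := fun h0 => h.a_ne (hθ _ h0)
  c_ne := fun h0 => h.c_ne (hθ _ h0)
  d_ne := fun h0 => h.d_ne (hθ _ h0)
  q_pow := fun i hi hi' => pow_ne_one_of_specialization hθ (h.q_pow i hi hi')
  q_one := by
    rw [← pow_one (θ (X 0))]
    exact pow_ne_one_of_specialization hθ (by rw [pow_one]; exact h.q_one)
  a_pow := pow_ne_one_of_specialization hθ h.a_pow
  a_shift := fun j hj => ⟨fun h0 => (h.a_shift j hj).1 (by
      rw [← map_pow] at h0 ⊢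
      exact eq_of_specialization hθ h0),
    fun h0 => (h.a_shift j hj).2 (by
      rw [← map_pow, ← map_mul, ← map_one θ] at h0
      rw [← map_pow, ← map_mul, ← map_one ψ]
      exact eq_of_specialization hθ h0)⟩
  c_shift := fun j h0 => h.c_shift j (by
    rw [← map_pow] at h0 ⊢
    exact eq_of_specialization hθ h0)
  d_shift := fun j h0 => h.d_shift j (by
    rw [← map_pow] at h0 ⊢
    exact eq_of_specialization hθ h0)

theorem two_pow_ne_one {m : ℕ} (hm : 0 < m) : (2 : ℚ) ^ m ≠ 1 :=
  (one_lt_pow₀ (by norm_num) hm.ne').ne'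

/-- A point on a = q^n: powers of 2 are positive, so c = d = -1 avoids them, and the exponent of a
is odd while the forbidden ones are even. -/
theorem nondegenerate_two (N : ℕ) : Nondegenerate N (2 : ℚ) (2 ^ (4 * N + 1)) (-1) (-1) where
  q_ne := two_ne_zero
  a_ne := by positivity
  c_ne := by norm_num
  d_ne := by norm_num
  q_pow := fun i hi _ => two_pow_ne_one hi
  q_one := by norm_num
  a_pow := by rw [← pow_mul]; exact two_pow_ne_one (by positivity)
  a_shift := fun j _ => ⟨fun h0 => by
      have := pow_right_injective₀ (by norm_num : (0 : ℚ) < 2) (by norm_num) h0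
      omega, by rw [← pow_add]; exact two_pow_ne_one (by positivity)⟩
  c_shift := fun j => (lt_trans (by norm_num) (by positivity : (0 : ℚ) < 2 ^ j)).ne
  d_shift := fun j => (lt_trans (by norm_num) (by positivity : (0 : ℚ) < 2 ^ j)).ne

theorem nondegenerate_root {N : ℕ} (hN : 0 < N) {ζ : ℂ} (hζ : IsPrimitiveRoot ζ (4 * N + 1)) :
    Nondegenerate N ζ (2 : ℂ) 2 2 := by
  have hnorm : ∀ j, ‖ζ ^ j‖ = 1 := fun j => by
    rw [norm_pow, hζ.norm'_eq_one (Nat.succ_ne_zero _), one_pow]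
  have h2 : ∀ j, (2 : ℂ) ≠ ζ ^ j := fun j h0 => by
    have := congrArg norm h0
    rw [hnorm] at this
    norm_num at this
  exact
  { q_ne := fun h0 => by simpa [h0] using hnorm 1
    a_ne := two_ne_zero
    c_ne := two_ne_zero
    d_ne := two_ne_zero
    q_pow := fun i hi hi' => hζ.pow_ne_one_of_pos_of_lt hi.ne' (by omega)
    q_one := by
      have := hζ.pow_ne_one_of_pos_of_lt one_ne_zero (by omega : 1 < 4 * N + 1)
      rwa [pow_one] at this
    a_pow := fun h0 => by
      have := congrArg norm h0
      rw [norm_pow, norm_one, Complex.norm_ofNat] at this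
      exact (one_lt_pow₀ (by norm_num : (1 : ℝ) < 2) (Nat.succ_ne_zero (4 * N))).ne' this
    a_shift := fun j _ => ⟨h2 _, fun h0 => by
      have := congrArg norm h0
      rw [norm_mul, hnorm] at this
      norm_num at this⟩
    c_shift := h2
    d_shift := h2 }

end Nondegeneracy

/-! ### Divisibility of the numerator by each factor of the modulus. -/

section Main

open MvPolynomial

variable {N : ℕ}

theorem residueField_kernel_le {I : Ideal Poly4} [I.IsPrime] {p : Poly4} (hI : I = Ideal.span {p})
    {G : Type*} [Field G] {ψ : Poly4 →+* G} (hψ : ψ p = 0) (f : Poly4)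
    (hf : algebraMap Poly4 I.ResidueField f = 0) : ψ f = 0 := by
  obtain ⟨g, rfl⟩ := (algebraMap_residueField_eq_zero_iff hI f).1 hf
  rw [map_mul, hψ, zero_mul]

theorem not_dvd_of_map {G : Type*} [Field G] (ψ : Poly4 →+* G) {p f : Poly4} (hp : ψ p = 0)
    (hf : ψ f ≠ 0) : ¬ p ∣ f := by
  rintro ⟨g, rfl⟩
  exact hf (by rw [map_mul, hp, zero_mul])

/-- The difference of the two sides of the congruence. -/
noncomputable def sideDifference (N : ℕ) : Rat4 :=
  lhsSum (4 * N + 1) (ratVar 0) (ratVar 1) (ratVar 2) (ratVar 3)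
    - rhsFactor (4 * N + 1) (ratVar 0) (ratVar 1)
      * rhsSum (4 * N + 1) (ratVar 0) (ratVar 1) (ratVar 2) (ratVar 3)

/-- Divisibility of the numerator by a linear factor, given that both sides agree on its zero set. -/
theorem dvd_num_of_agree {p : Poly4} (hp : Prime p) {G : Type*} [Field G] {ψ : Poly4 →+* G}
    (hψ : ψ p = 0) (hnd : Nondegenerate N (ψ (X 0)) (ψ (X 1)) (ψ (X 2)) (ψ (X 3)))
    (hpow : ∀ m, 0 < m → ψ (X 0) ^ m ≠ 1)
    (agree : ∀ {K : Type} [Field K] (θ : Poly4 →+* K), θ p = 0 →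
      Nondegenerate N (θ (X 0)) (θ (X 1)) (θ (X 2)) (θ (X 3)) →
      (∀ m, 0 < m → θ (X 0) ^ m ≠ 1) →
      lhsSum (4 * N + 1) (θ (X 0)) (θ (X 1)) (θ (X 2)) (θ (X 3))
        = rhsFactor (4 * N + 1) (θ (X 0)) (θ (X 1))
          * rhsSum (4 * N + 1) (θ (X 0)) (θ (X 1)) (θ (X 2)) (θ (X 3)))
    {U V : Poly4} (hV : V ≠ 0)
    (hUV : sideDifference N = algebraMap Poly4 Rat4 U / algebraMap Poly4 Rat4 V) : p ∣ U := by
  obtain ⟨I, hI⟩ : ∃ I, I = Ideal.span {p} := ⟨_, rfl⟩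
  have : I.IsPrime := by rw [hI]; exact (Ideal.span_singleton_prime hp.ne_zero).2 hp
  have hker := residueField_kernel_le hI hψ
  have hnd' := Nondegenerate.of_specialization hker hnd
  have heq := agree (algebraMap Poly4 I.ResidueField)
    ((algebraMap_residueField_eq_zero_iff hI p).2 dvd_rfl) hnd'
    (fun m hm => pow_ne_one_of_specialization hker (hpow m hm))
  have hred := (ReducesTo.lhsSum (reducesTo_algebraMap I (X 0)) (reducesTo_algebraMap I (X 1))
    (reducesTo_algebraMap I (X 2)) (reducesTo_algebraMap I (X 3)) hnd').sub
    (ReducesTo.rhs (reducesTo_algebraMap I (X 0)) (reducesTo_algebraMap I (X 1))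
    (reducesTo_algebraMap I (X 2)) (reducesTo_algebraMap I (X 3)) hnd')
  rw [heq, sub_self] at hred
  obtain ⟨o, ho, hz⟩ := hred
  obtain ⟨w, rfl⟩ := dvd_of_residue_eq_zero hI o hz
  rw [← pow_one p]
  exact pow_dvd_num_of_eq hp hI (m := 1) (o := w) (by rw [pow_one]; exact ho.symm) hV hUV

/-- Evaluation at `q = 2`, `a = α`, `c = d = -1`. -/
noncomputable def evalAtTwo (α : ℚ) : Poly4 →+* ℚ :=
  (aeval ![2, α, -1, -1] : Poly4 →ₐ[ℤ] ℚ).toRingHom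

theorem evalAtTwo_X (α : ℚ) (j : Fin 4) : evalAtTwo α (X j) = ![2, α, -1, -1] j :=
  aeval_X _ j

/-- Evaluation at `q = ζ`, `a = c = d = 2`. -/
noncomputable def evalAtRoot (ζ : ℂ) : Poly4 →+* ℂ :=
  (aeval ![ζ, 2, 2, 2] : Poly4 →ₐ[ℤ] ℂ).toRingHom

theorem evalAtRoot_X (ζ : ℂ) (j : Fin 4) : evalAtRoot ζ (X j) = ![ζ, 2, 2, 2] j :=
  aeval_X _ j

theorem evalAtRoot_cyclotomic {ζ : ℂ} {n : ℕ} (hn : 0 < n) (hζ : IsPrimitiveRoot ζ n) :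
    evalAtRoot ζ (Polynomial.aeval (X 0 : Poly4) (Polynomial.cyclotomic n ℤ)) = 0 := by
  have h := Polynomial.aeval_algHom_apply (aeval ![ζ, 2, 2, 2] : Poly4 →ₐ[ℤ] ℂ) (X 0)
    (Polynomial.cyclotomic n ℤ)
  refine h.symm.trans ?_
  rw [aeval_X, Polynomial.aeval_def, ← Polynomial.eval_map, Polynomial.map_cyclotomic]
  exact hζ.isRoot_cyclotomic hn

theorem nondegenerate_ratVar (N : ℕ) :
    Nondegenerate N (ratVar 0) (ratVar 1) (ratVar 2) (ratVar 3) ∧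
      ∀ m, 0 < m → ratVar 0 ^ m ≠ 1 := by
  have hker : ∀ f, algebraMap Poly4 Rat4 f = 0 → evalAtTwo (2 ^ (4 * N + 1)) f = 0 := fun f hf => by
    rw [IsFractionRing.injective Poly4 Rat4 (hf.trans (map_zero _).symm), map_zero]
  refine ⟨Nondegenerate.of_specialization hker ?_, fun m hm =>
    pow_ne_one_of_specialization hker ?_⟩
  · simp only [evalAtTwo_X]
    exact nondegenerate_two N
  · rw [evalAtTwo_X]
    exact two_pow_ne_one hm

theorem X_one_sub_dvd_num {U V : Poly4} (hV : V ≠ 0)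
    (hUV : sideDifference N = algebraMap Poly4 Rat4 U / algebraMap Poly4 Rat4 V) :
    (X 1 - X 0 ^ (4 * N + 1) : Poly4) ∣ U := by
  refine dvd_num_of_agree (prime_X_one_sub _) (ψ := evalAtTwo (2 ^ (4 * N + 1))) ?_ ?_ ?_ ?_ hV hUV
  · rw [map_sub, map_pow, evalAtTwo_X, evalAtTwo_X]; exact sub_self _
  · simp only [evalAtTwo_X]
    exact nondegenerate_two N
  · rw [evalAtTwo_X]
    exact fun m => two_pow_ne_one
  · intro K _ θ hp hnd hq
    have ha : θ (X 1) = θ (X 0) ^ (4 * N + 1) := by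
      rwa [map_sub, map_pow, sub_eq_zero] at hp
    rw [lhsSum_eq_of_eq_pow hnd hq ha, rhsFactor_eq_of_hNum_eq_zero]
    rw [hNum, ← ha, sub_self, mul_zero, zero_mul]

theorem one_sub_X_mul_dvd_num {U V : Poly4} (hV : V ≠ 0)
    (hUV : sideDifference N = algebraMap Poly4 Rat4 U / algebraMap Poly4 Rat4 V) :
    (1 - X 1 * X 0 ^ (4 * N + 1) : Poly4) ∣ U := by
  refine dvd_num_of_agree (prime_one_sub_X_mul _) (ψ := evalAtTwo (2 ^ (4 * N + 1))⁻¹)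
    ?_ ?_ ?_ ?_ hV hUV
  · rw [map_sub, map_one, map_mul, map_pow, evalAtTwo_X, evalAtTwo_X, sub_eq_zero]
    exact (inv_mul_cancel₀ (pow_ne_zero _ two_ne_zero)).symm
  · simp only [evalAtTwo_X]
    exact (nondegenerate_two N).inv
  · rw [evalAtTwo_X]
    exact fun m => two_pow_ne_one
  · intro K _ θ hp hnd hq
    have ha : θ (X 1) * θ (X 0) ^ (4 * N + 1) = 1 := by
      rw [map_sub, map_one, map_mul, map_pow, sub_eq_zero] at hp
      exact hp.symm
    have ha' : (θ (X 1))⁻¹ = θ (X 0) ^ (4 * N + 1) := inv_eq_of_mul_eq_one_right ha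
    rw [← lhsSum_inv, ← rhsSum_inv, lhsSum_eq_of_eq_pow hnd.inv hq ha',
      rhsFactor_eq_of_hNum_eq_zero]
    rw [hNum, ha, sub_self, zero_mul, zero_mul]

theorem cyclotomic_sq_dvd_num (hN : 0 < N) {U V : Poly4} (hV : V ≠ 0)
    (hUV : sideDifference N = algebraMap Poly4 Rat4 U / algebraMap Poly4 Rat4 V) :
    Polynomial.aeval (X 0 : Poly4) (Polynomial.cyclotomic (4 * N + 1) ℤ) ^ 2 ∣ U := by
  set p := Polynomial.aeval (X 0 : Poly4) (Polynomial.cyclotomic (4 * N + 1) ℤ) with hpdef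
  have hp : Prime p := prime_cyclotomic_X (Nat.succ_pos _)
  obtain ⟨ζ, hζ⟩ : ∃ ζ : ℂ, IsPrimitiveRoot ζ (4 * N + 1) :=
    ⟨_, Complex.isPrimitiveRoot_exp _ (Nat.succ_ne_zero _)⟩
  obtain ⟨I, hI⟩ : ∃ I, I = Ideal.span {p} := ⟨_, rfl⟩
  have : I.IsPrime := by rw [hI]; exact (Ideal.span_singleton_prime hp.ne_zero).2 hp
  have hker := residueField_kernel_le hI (evalAtRoot_cyclotomic (Nat.succ_pos _) hζ)
  have hnd := nondegenerate_root hN hζ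
  have hnd' : Nondegenerate N (algebraMap Poly4 I.ResidueField (X 0))
      (algebraMap Poly4 I.ResidueField (X 1)) (algebraMap Poly4 I.ResidueField (X 2))
      (algebraMap Poly4 I.ResidueField (X 3)) := by
    refine Nondegenerate.of_specialization hker ?_
    simp only [evalAtRoot_X]
    exact hnd
  -- An integer that vanishes in the residue field vanishes at the complex point as well.
  -- Characteristic zero makes the field infinite and 2 invertible, as the pairwise cancellation
  -- requires.
  have : CharZero I.ResidueField := charZero_of_inj_zero fun n hn => by
    have h0 := hker (n : Poly4) (by rw [map_natCast]; exact hn)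
    rw [map_natCast] at h0
    exact_mod_cast h0
  have hroot : IsPrimitiveRoot (algebraMap Poly4 I.ResidueField (X 0)) (4 * N + 1) := by
    refine IsPrimitiveRoot.mk_of_lt _ (Nat.succ_pos _) ?_ fun l hl hl' =>
      hnd'.q_pow l hl (by omega)
    have hdvd : p ∣ X 0 ^ (4 * N + 1) - 1 := by
      have := map_dvd (Polynomial.aeval (X 0 : Poly4))
        (Polynomial.cyclotomic.dvd_X_pow_sub_one (4 * N + 1) ℤ)
      simpa using this
    have := (algebraMap_residueField_eq_zero_iff hI _).2 hdvd
    rwa [map_sub, map_pow, map_one, sub_eq_zero] at this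
  obtain ⟨hF, hqF⟩ := nondegenerate_ratVar N
  obtain ⟨o, ho⟩ := lhsSum_sub_eq_sq (dvd_of_residue_eq_zero hI) (reducesTo_algebraMap I (X 0))
    (reducesTo_algebraMap I (X 1)) (reducesTo_algebraMap I (X 2)) (reducesTo_algebraMap I (X 3))
    hnd' hF hqF hroot
  exact pow_dvd_num_of_eq hp hI ho hV hUV

theorem modulus_dvd_num (hN : 0 < N) {U V : Poly4} (hV : V ≠ 0)
    (hUV : sideDifference N = algebraMap Poly4 Rat4 U / algebraMap Poly4 Rat4 V) :
    modulus (4 * N + 1) ∣ U := by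
  obtain ⟨ζ, hζ⟩ : ∃ ζ : ℂ, IsPrimitiveRoot ζ (4 * N + 1) :=
    ⟨_, Complex.isPrimitiveRoot_exp _ (Nat.succ_ne_zero _)⟩
  have hp : Prime (Polynomial.aeval (X 0 : Poly4) (Polynomial.cyclotomic (4 * N + 1) ℤ)) :=
    prime_cyclotomic_X (Nat.succ_pos _)
  have hζ0 := evalAtRoot_cyclotomic (Nat.succ_pos _) hζ
  have c1 : IsRelPrime (Polynomial.aeval (X 0 : Poly4) (Polynomial.cyclotomic (4 * N + 1) ℤ))
      (X 1 - X 0 ^ (4 * N + 1)) := by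
    refine hp.irreducible.isRelPrime_iff_not_dvd.2 (not_dvd_of_map (evalAtRoot ζ) hζ0 ?_)
    rw [map_sub, map_pow, evalAtRoot_X, evalAtRoot_X]
    change (2 : ℂ) - ζ ^ (4 * N + 1) ≠ 0
    rw [hζ.pow_eq_one]; norm_num
  have c2 : IsRelPrime (Polynomial.aeval (X 0 : Poly4) (Polynomial.cyclotomic (4 * N + 1) ℤ))
      (1 - X 1 * X 0 ^ (4 * N + 1)) := by
    refine hp.irreducible.isRelPrime_iff_not_dvd.2 (not_dvd_of_map (evalAtRoot ζ) hζ0 ?_)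
    rw [map_sub, map_mul, map_pow, map_one, evalAtRoot_X, evalAtRoot_X]
    change 1 - (2 : ℂ) * ζ ^ (4 * N + 1) ≠ 0
    rw [hζ.pow_eq_one]; norm_num
  have c3 : IsRelPrime (X 1 - X 0 ^ (4 * N + 1) : Poly4) (1 - X 1 * X 0 ^ (4 * N + 1)) := by
    refine (prime_X_one_sub _).irreducible.isRelPrime_iff_not_dvd.2
      (not_dvd_of_map (evalAtTwo (2 ^ (4 * N + 1))) ?_ ?_)
    · rw [map_sub, map_pow, evalAtTwo_X, evalAtTwo_X]; exact sub_self _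
    · rw [map_sub, map_mul, map_pow, map_one, evalAtTwo_X, evalAtTwo_X]
      change 1 - (2 : ℚ) ^ (4 * N + 1) * 2 ^ (4 * N + 1) ≠ 0
      rw [← pow_add]
      exact fun h0 => two_pow_ne_one (by omega) (sub_eq_zero.1 h0).symm
  refine IsRelPrime.mul_dvd ?_ (IsRelPrime.mul_dvd c1.pow_left (cyclotomic_sq_dvd_num hN hV hUV)
    (X_one_sub_dvd_num hV hUV)) (one_sub_X_mul_dvd_num hV hUV)
  exact IsRelPrime.mul_left c2.pow_left c3

theorem sideDifference_zero : sideDifference 0 = 0 := by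
  simp [sideDifference, lhsSum, rhsSum, rhsFactor, hNum, qPoch]

end Main

theorem theorem4 (n : ℕ) (hn : 0 < n) (hmod : n ≡ 1 [MOD 4]) :
    RatCongr (modulus n)
      (lhsSum n (ratVar 0) (ratVar 1) (ratVar 2) (ratVar 3))
      (rhsFactor n (ratVar 0) (ratVar 1)
        * rhsSum n (ratVar 0) (ratVar 1) (ratVar 2) (ratVar 3)) := by
  obtain ⟨N, rfl⟩ : ∃ N, n = 4 * N + 1 := ⟨n / 4, by unfold Nat.ModEq at hmod; omega⟩
  rcases Nat.eq_zero_or_pos N with rfl | hN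
  -- For n = 1 reduction modulo q - 1 would kill the denominators 1 - q, but the two sides are equal
  -- outright.
  · refine ⟨0, 1, one_ne_zero, isRelPrime_one_right, ?_⟩
    rw [mul_zero (modulus _), map_zero (algebraMap Poly4 Rat4), zero_div]
    exact sideDifference_zero
  -- In lowest terms, a divisor of the numerator is automatically coprime to the denominator.
  · obtain ⟨U, V, hrel, hUV⟩ := IsFractionRing.exists_reduced_fraction Poly4 (sideDifference N)
    have hV : (V : Poly4) ≠ 0 := nonZeroDivisors.coe_ne_zero V
    rw [IsFractionRing.mk'_eq_div] at hUV
    obtain ⟨u, rfl⟩ := modulus_dvd_num hN hV hUV.symm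
    exact ⟨u, V, hV, hrel.of_mul_left_left, hUV.symm⟩
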